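/- Let the double pentagon be the translation surface obtained from a regular pentagon $P$ with a horizontal bottom side and its image $-P$ under the central symmetry $z\mapsto -z$ (both centered at the origin of their own plane) by gluing each side of $P$ to the parallel side of $-P$ by a translation. Label the sides of $P$, counterclockwise from the horizontal bottom side, by $3,5,2,4,1$, and give each side of $-P$ the label of the side of $P$ that it is glued to. Consider a direction $\theta$ in the third sector, i.e. making an angle $72^\circ\le\theta\le108^\circ$ with the horizontal side and diagonal, and assume that $\theta$ is periodic, i.e. that some linear trajectory of direction $\theta$ avoiding the vertices is closed. The symbolic orbit of a closed trajectory (traversed once) is the cyclic word of the labels of the sides that it crosses consecutively; it is rewritten as a cyclic word in the symbols I, II, III, IV by replacing the pairs of consecutive labels $43\to\mathrm{I}$, $41\to\mathrm{II}$, $25\to\mathrm{III}$, $23\to\mathrm{IV}$. A closed trajectory of direction $\theta$ is called short (long) if its length is the least (greatest) among all closed trajectories of direction $\theta$. Then there are short and long closed trajectories of direction $\theta$, and every closed trajectory of direction $\theta$ is short or long. If $(c,d,e,f)$ and $(C,D,E,F)$ are the numbers of occurrences of the symbols I, II, III, IV in the symbolic orbits of a short and of a long closed trajectory of direction $\theta$,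 respectively, then $$C=c+e,\qquad D=f,\qquad E=c,\qquad F=d+f .$$ Equivalently, $(C,D,E,F)^T=M\,(c,d,e,f)^T$, where $$M=\begin{pmatrix}1&0&1&0\\0&0&0&1\\1&0&0&0\\0&1&0&1\end{pmatrix},\qquad M^2=M+I .$$ Moreover, the number of sides crossed during one period by a short trajectory is at most the number of sides crossed during one period by a long one. -/

import Mathlib

noncomputable section

namespace DoublePentagon

/-- The labels of the five pairs of identified sides of the double pentagon. -/
inductive Side
  | s1 | s2 | s3 | s4 | s5
  deriving DecidableEq

/-- The two regular pentagons that make up the double pentagon: `up` has its horizontal side at the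
bottom, `down` is its image under the central symmetry `z ↦ -z`. -/
inductive Copy
  | up | down
  deriving DecidableEq

/-- The other pentagon. -/
def Copy.other : Copy → Copy
  | .up => .down
  | .down => .up

/-- `1` for the first pentagon, `-1` for its centrally symmetric image. -/
def Copy.sign : Copy → ℝ
  | .up => 1
  | .down => -1

/-- The polar angle of the outward normal of a side of the pentagon `up`. Counterclockwise from the
horizontal bottom side the labels are 3, 5, 2, 4, 1; thus the sides 3, 4, 5, 1, 2 have the
directions 0°, 36°, 72°, 108°, 144°. -/
def Side.angle : Side → ℝ
  | .s3 => -(Real.pi / 2)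
  | .s5 => -(Real.pi / 2) + 2 * Real.pi / 5
  | .s2 => -(Real.pi / 2) + 4 * Real.pi / 5
  | .s4 => -(Real.pi / 2) + 6 * Real.pi / 5
  | .s1 => -(Real.pi / 2) + 8 * Real.pi / 5

/-- The outward unit normal of a side of the pentagon `up`; as the pentagons are centered at the
origin and have inradius 1, it is also the midpoint of that side. -/
def Side.normal (s : Side) : ℂ := Complex.exp (s.angle * Complex.I)

/-- The open regular pentagon, center 0 and inradius 1, as an intersection of half-planes; for
`down` it is the image under `z ↦ -z`. -/
def Copy.interior (c : Copy) : Set ℂ :=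
  {z | ∀ s : Side, inner ℝ s.normal ((c.sign : ℂ) * z) < 1}

/-- The side with label `s`, without its end points, of the pentagon `c`. -/
def Copy.openSide (c : Copy) (s : Side) : Set ℂ :=
  {z | inner ℝ s.normal ((c.sign : ℂ) * z) = 1 ∧
    ∀ s' : Side, s' ≠ s → inner ℝ s'.normal ((c.sign : ℂ) * z) < 1}

/-- The event that a trajectory leaves the pentagon `copy` through the point `point` of its side
with label `side`. -/
structure Crossing where
  copy : Copy
  side : Side
  point : ℂ

/-- The same point of the surface, seen as a point of the boundary of the other pentagon: equally
labelled (parallel) sides are identified by the translation that takes midpoint to midpoint. -/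
def Crossing.entry (a : Crossing) : ℂ :=
  a.point - 2 * (a.copy.sign : ℂ) * a.side.normal

/-- The unit vector of direction `θ`. -/
def dir (θ : ℝ) : ℂ := Complex.exp (θ * Complex.I)

/-- `b` is the crossing that follows `a` on a trajectory of direction `θ`: after the crossing `a`
the trajectory goes straight through the inside of the other pentagon and leaves it at `b`. -/
def Step (θ : ℝ) (a b : Crossing) : Prop :=
  b.copy = a.copy.other ∧
    ∃ t : ℝ, 0 < t ∧ b.point = a.entry + (t : ℂ) * dir θ ∧
      ∀ r : ℝ, 0 < r → r < t → a.entry + (r : ℂ) * dir θ ∈ b.copy.interior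

/-- A periodic linear trajectory of direction `θ` on the double pentagon that avoids the vertices,
recorded by its consecutive crossings of the sides, with its prime period. -/
structure ClosedTrajectory (θ : ℝ) where
  crossing : ℕ → Crossing
  period : ℕ
  period_pos : 0 < period
  mem_openSide : ∀ k, (crossing k).point ∈ (crossing k).copy.openSide (crossing k).side
  step : ∀ k, Step θ (crossing k) (crossing (k + 1))
  periodic : ∀ k, crossing (k + period) = crossing k
  prime : ∀ m, 0 < m → m < period → crossing m ≠ crossing 0

/-- A direction is periodic if there is a periodic trajectory of that direction. -/
def IsPeriodicDirection (θ : ℝ) : Prop := Nonempty (ClosedTrajectory θ)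

/-- The third sector of directions: the angle with the horizontal diagonal is between 72° and
108°. It is bounded by the directions of two diagonals of the pentagon. -/
def thirdSector : Set ℝ := Set.Icc (2 * Real.pi / 5) (3 * Real.pi / 5)

/-- The symbols of the second coding. -/
inductive Roman
  | I | II | III | IV
  deriving DecidableEq

/-- The translation 43 ↦ I, 41 ↦ II, 25 ↦ III, 23 ↦ IV of pairs of consecutive sides (a crossing
of the side 4 or 2, followed by a crossing of the side 3, 1 or 5). -/
def romanOfPair : Side → Side → Option Roman
  | .s4, .s3 => some .I
  | .s4, .s1 => some .II
  | .s2, .s5 => some .III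
  | .s2, .s3 => some .IV
  | _, _ => none

namespace ClosedTrajectory

variable {θ : ℝ}

/-- The (Euclidean) length of a periodic trajectory. -/
def length (γ : ClosedTrajectory θ) : ℝ :=
  ∑ k ∈ Finset.range γ.period, ‖(γ.crossing (k + 1)).point - (γ.crossing k).entry‖

/-- The symbolic orbit in the symbols I, …, IV, a representative of a cyclic word: the cyclic word
of the labels of the sides crossed during one period, with each pair 43, 41, 25, 23 of cyclically
consecutive labels replaced by its symbol. (For the last `k` of the period, the crossing number
`k + 1` is the crossing number `0`.) -/
def romanWord (γ : ClosedTrajectory θ) : List Roman :=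
  (List.range γ.period).filterMap fun k =>
    romanOfPair (γ.crossing k).side (γ.crossing (k + 1)).side

/-- The number of occurrences of a symbol in the symbolic orbit. -/
def count (γ : ClosedTrajectory θ) (r : Roman) : ℕ := γ.romanWord.count r

/-- The vector of the numbers of occurrences of I, II, III, IV. -/
def countVec (γ : ClosedTrajectory θ) : Fin 4 → ℕ :=
  ![γ.count .I, γ.count .II, γ.count .III, γ.count .IV]

/-- A short orbit: the length is the least one among all periodic trajectories of the direction. -/
def IsShort (γ : ClosedTrajectory θ) : Prop :=
  ∀ δ : ClosedTrajectory θ, γ.length ≤ δ.length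

/-- A long orbit: the length is the greatest one among all periodic trajectories of the
direction. -/
def IsLong (γ : ClosedTrajectory θ) : Prop :=
  ∀ δ : ClosedTrajectory θ, δ.length ≤ γ.length

end ClosedTrajectory

/-- The matrix of the relation between the two vectors. -/
def relMatrix : Matrix (Fin 4) (Fin 4) ℕ :=
  !![1, 0, 1, 0;
     0, 0, 0, 1;
     1, 0, 0, 0;
     0, 1, 0, 1]

end DoublePentagon

end

/-! In the third sector every trajectory leaves `up` through side 4 or 2, so it is governed by the
first return map to these two sides. In the coordinate transverse to the flow this is the exchange
`pentagonExchange a b` of four intervals of lengths φb, a, b, φa (symbols I to IV), where a and b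
are the projected widths of sides 1 and 5 and φ is the golden ratio. Closed trajectories correspond
to periodic orbits, and `count` to the numbers of visits (`count_mem_visitVectors`,
`exists_closedTrajectory`).

Rauzy induction renormalizes this family. For φa ≤ b it turns (a, b) into (a, b - φa); for a ≤ b ≤
φa it turns it into (φa - b, φ(b - a)); a reflection swaps a and b. Numbers of visits change by the
linear substitutions `outerSubst`, `innerSubst` and `Roman.mirror`, all of which commute with
`relate`, the action of the matrix M. A periodic orbit loses visits at each step, so the process
ends, at the latest, at a = 0. There the exchange is the identity on I and III, with visit vectors
e_III and e_I = `relate` e_III. Going back, the visit vectors in every periodic direction are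
exactly v and `relate v` (`exists_visitVectors_eq`).

Finally, length is a linear function of the counts, and its weights form a left eigenvector of M
with eigenvalue φ (`slope_relations`). Hence v belongs to the short trajectories and `relate v` to
the long ones, which are φ times longer. -/

noncomputable section

/-! ### Interval exchanges, their periodic orbits, and symmetries -/

/-- Finitely many open intervals, separated from each other, with translations that carry them to
separated intervals. The interval number `i` is `(left i, left i + len i)`; its image is
`(target i, target i + len i)`. -/
structure IntervalExchange (ι : Type*) where
  left : ι → ℝ
  target : ι → ℝ
  len : ι → ℝ
  len_nonneg : ∀ i, 0 ≤ len i
  left_sep : ∀ i j, i ≠ j → left i + len i ≤ left j ∨ left j + len j ≤ left i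
  target_sep : ∀ i j, i ≠ j → target i + len i ≤ target j ∨ target j + len j ≤ target i

namespace IntervalExchange

variable {ι κ : Type*} (S : IntervalExchange ι)

theorem ext_data {S T : IntervalExchange ι} (h₁ : ∀ i, S.left i = T.left i)
    (h₂ : ∀ i, S.target i = T.target i) (h₃ : ∀ i, S.len i = T.len i) : S = T := by
  cases S; cases T
  simp only [mk.injEq]
  exact ⟨funext h₁, funext h₂, funext h₃⟩

/-- The point `x` belongs to the interval number `i`. -/
def Mem (i : ι) (x : ℝ) : Prop := S.left i < x ∧ x < S.left i + S.len i

instance (i : ι) : DecidablePred (S.Mem i) := fun _ => inferInstanceAs (Decidable (_ ∧ _))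

/-- The translation of the interval number `i`. -/
def move (i : ι) (x : ℝ) : ℝ := x - S.left i + S.target i

theorem move_injective (i : ι) : Function.Injective (S.move i) := fun x y h => by
  unfold move at h; linarith

variable {S} in
theorem Mem.eq {i j : ι} {x : ℝ} (hi : S.Mem i x) (hj : S.Mem j x) : i = j := by
  by_contra h
  rcases S.left_sep i j h with h | h <;> linarith [hi.1, hi.2, hj.1, hj.2]

/-- Every point of `O` lies in one of the intervals and is moved into `O`. -/
def IsInvariant (O : Finset ℝ) : Prop := ∀ x ∈ O, ∃ i, S.Mem i x ∧ S.move i x ∈ O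

/-- A periodic orbit, as a minimal nonempty finite invariant set. -/
structure IsOrbit (O : Finset ℝ) : Prop where
  nonempty : O.Nonempty
  invariant : S.IsInvariant O
  minimal : ∀ V ⊆ O, V.Nonempty → S.IsInvariant V → V = O

/-- The number of points of `O` in each of the intervals. -/
def visits (O : Finset ℝ) (i : ι) : ℕ := (O.filter (S.Mem i)).card

/-- The vectors of the numbers of visits of the periodic orbits. -/
def visitVectors : Set (ι → ℕ) := {n | ∃ O, S.IsOrbit O ∧ S.visits O = n}

/-- The inverse exchange. -/
@[simps] def inverse : IntervalExchange ι where
  left := S.target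
  target := S.left
  len := S.len
  len_nonneg := S.len_nonneg
  left_sep := S.target_sep
  target_sep := S.left_sep

/-- The exchange conjugated by `x ↦ c - x`. -/
@[simps] def reflect (c : ℝ) : IntervalExchange ι where
  left i := c - (S.left i + S.len i)
  target i := c - (S.target i + S.len i)
  len := S.len
  len_nonneg := S.len_nonneg
  left_sep i j h := by rcases S.left_sep i j h with h | h <;> [right; left] <;> linarith
  target_sep i j h := by rcases S.target_sep i j h with h | h <;> [right; left] <;> linarith

/-- The exchange with its intervals renamed. -/
@[simps] def reindex (e : κ ≃ ι) : IntervalExchange κ where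
  left i := S.left (e i)
  target i := S.target (e i)
  len i := S.len (e i)
  len_nonneg _ := S.len_nonneg _
  left_sep _ _ h := S.left_sep _ _ (e.injective.ne h)
  target_sep _ _ h := S.target_sep _ _ (e.injective.ne h)

variable {S}

/-- The map is injective because the images of the intervals are separated, and an injective
self-map of a finite set is onto. This makes invariance symmetric under inversion of the exchange.
-/
theorem IsInvariant.exists_preimage {O : Finset ℝ} (hO : S.IsInvariant O) {y : ℝ} (hy : y ∈ O) :
    ∃ x ∈ O, ∃ i, S.Mem i x ∧ S.move i x = y := by
  have : Nonempty ι := (hO y hy).nonempty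
  choose! f hf using hO
  have hmaps : Set.MapsTo (fun x => S.move (f x) x) O O := fun x hx => (hf x hx).2
  have hinj : Set.InjOn (fun x => S.move (f x) x) (O : Set ℝ) := by
    intro x hx y hy hxy
    have hx := (hf x hx).1
    have hy := (hf y hy).1
    simp only [Mem, move] at hx hy hxy
    have : f x = f y := by
      by_contra h
      rcases S.target_sep _ _ h with h | h <;> linarith [hx.1, hx.2, hy.1, hy.2]
    rw [this] at hxy
    linarith
  obtain ⟨x, hx, rfl⟩ := Finset.surj_on_of_inj_on_of_card_le (s := O) (t := O)
    (fun x _ => S.move (f x) x) (fun _ hx => hmaps hx) (fun _ _ hx hy h => hinj hx hy h) le_rfl y hy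
  exact ⟨x, hx, f x, (hf x hx).1, rfl⟩

theorem Mem.inverse_move {i : ι} {x : ℝ} (h : S.Mem i x) : S.inverse.Mem i (S.move i x) := by
  simp only [Mem, inverse_left, inverse_len, move] at *
  constructor <;> linarith [h.1, h.2]

theorem inverse_move_move (i : ι) (x : ℝ) : S.inverse.move i (S.move i x) = x := by
  simp [move]

theorem IsInvariant.inverse {O : Finset ℝ} (hO : S.IsInvariant O) : S.inverse.IsInvariant O := by
  intro y hy
  obtain ⟨x, hx, i, hi, rfl⟩ := hO.exists_preimage hy
  exact ⟨i, hi.inverse_move, by rwa [inverse_move_move]⟩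

theorem IsOrbit.inverse {O : Finset ℝ} (hO : S.IsOrbit O) : S.inverse.IsOrbit O :=
  ⟨hO.nonempty, hO.invariant.inverse, fun V hV hne hinv => hO.minimal V hV hne hinv.inverse⟩

theorem IsInvariant.visits_inverse {O : Finset ℝ} (hO : S.IsInvariant O) :
    S.inverse.visits O = S.visits O := by
  funext i
  refine (Finset.card_bij (fun x _ => S.move i x) ?_ (fun x _ y _ h => S.move_injective i h)
    ?_).symm
  · intro x hx
    rw [Finset.mem_filter] at hx ⊢
    obtain ⟨j, hj, hm⟩ := hO x hx.1
    obtain rfl := hj.eq hx.2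
    exact ⟨hm, hj.inverse_move⟩
  · intro y hy
    rw [Finset.mem_filter] at hy
    obtain ⟨x, hx, j, hj, rfl⟩ := hO.exists_preimage hy.1
    obtain rfl := hj.inverse_move.eq hy.2
    exact ⟨x, Finset.mem_filter.2 ⟨hx, hj⟩, rfl⟩

theorem visitVectors_inverse_subset (S : IntervalExchange ι) :
    S.visitVectors ⊆ S.inverse.visitVectors := by
  rintro _ ⟨O, hO, rfl⟩
  exact ⟨O, hO.inverse, hO.invariant.visits_inverse⟩

theorem visitVectors_inverse (S : IntervalExchange ι) :
    S.inverse.visitVectors = S.visitVectors :=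
  (visitVectors_inverse_subset S.inverse).antisymm (visitVectors_inverse_subset S)

theorem reflect_reflect (S : IntervalExchange ι) (c : ℝ) : (S.reflect c).reflect c = S :=
  ext_data (fun i => by simp only [reflect_left, reflect_len]; ring)
    (fun i => by simp only [reflect_target, reflect_len]; ring) fun _ => rfl

theorem mem_reflect {c : ℝ} {i : ι} {x : ℝ} : (S.reflect c).Mem i (c - x) ↔ S.Mem i x := by
  simp only [Mem, reflect_left, reflect_len]
  constructor <;> rintro ⟨h₁, h₂⟩ <;> constructor <;> linarith

theorem IsInvariant.reflect {O : Finset ℝ} (hO : S.IsInvariant O) (c : ℝ) :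
    (S.reflect c).IsInvariant (O.map (Equiv.subLeft c).toEmbedding) := by
  intro y hy
  obtain ⟨x, hx, rfl⟩ := Finset.mem_map.1 hy
  obtain ⟨i, hi, hm⟩ := hO x hx
  refine ⟨i, mem_reflect.2 hi, Finset.mem_map.2 ⟨_, hm, ?_⟩⟩
  simp [move]
  ring

theorem map_subLeft_map_subLeft (c : ℝ) (O : Finset ℝ) :
    (O.map (Equiv.subLeft c).toEmbedding).map (Equiv.subLeft c).toEmbedding = O := by
  ext x
  simp

theorem IsOrbit.reflect {O : Finset ℝ} (hO : S.IsOrbit O) (c : ℝ) :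
    (S.reflect c).IsOrbit (O.map (Equiv.subLeft c).toEmbedding) where
  nonempty := hO.nonempty.map
  invariant := hO.invariant.reflect c
  minimal V hV hne hinv := by
    have := hO.minimal (V.map (Equiv.subLeft c).toEmbedding)
      (by rw [← map_subLeft_map_subLeft c O]; exact Finset.map_subset_map.2 hV) hne.map
      (by simpa only [reflect_reflect] using hinv.reflect c)
    rw [← this, map_subLeft_map_subLeft]

theorem visits_reflect (O : Finset ℝ) (c : ℝ) :
    (S.reflect c).visits (O.map (Equiv.subLeft c).toEmbedding) = S.visits O := by
  funext i
  simp only [visits, Finset.filter_map, Finset.card_map]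
  congr 1
  exact Finset.filter_congr fun x _ => mem_reflect

theorem visitVectors_reflect (S : IntervalExchange ι) (c : ℝ) :
    (S.reflect c).visitVectors = S.visitVectors := by
  have key (S : IntervalExchange ι) : S.visitVectors ⊆ (S.reflect c).visitVectors := by
    rintro _ ⟨O, hO, rfl⟩
    exact ⟨_, hO.reflect c, visits_reflect O c⟩
  exact ((key _).trans_eq (by rw [reflect_reflect])).antisymm (key S)

theorem isInvariant_reindex (e : κ ≃ ι) {O : Finset ℝ} :
    (S.reindex e).IsInvariant O ↔ S.IsInvariant O :=
  forall₂_congr fun _ _ => e.exists_congr_left.trans (by simp [Mem, move])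

theorem visitVectors_reindex (S : IntervalExchange ι) (e : κ ≃ ι) :
    (S.reindex e).visitVectors = (fun n => n ∘ e) '' S.visitVectors := by
  have key (O : Finset ℝ) : (S.reindex e).IsOrbit O ↔ S.IsOrbit O :=
    ⟨fun h => ⟨h.1, (isInvariant_reindex e).1 h.2, fun V hV hne hinv =>
      h.3 V hV hne ((isInvariant_reindex e).2 hinv)⟩,
     fun h => ⟨h.1, (isInvariant_reindex e).2 h.2, fun V hV hne hinv =>
      h.3 V hV hne ((isInvariant_reindex e).1 hinv)⟩⟩
  ext n
  constructor
  · rintro ⟨O, hO, rfl⟩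
    exact ⟨_, ⟨O, (key O).1 hO, rfl⟩, rfl⟩
  · rintro ⟨_, ⟨O, hO, rfl⟩, rfl⟩
    exact ⟨O, (key O).2 hO, rfl⟩

/-! ### One step of Rauzy induction -/

section Cut

variable {p q : ι}

/-- The part of `O` outside of the image of the interval `q`. -/
def restrict (S : IntervalExchange ι) (q : ι) (O : Finset ℝ) : Finset ℝ :=
  O.filter fun x => ¬ S.inverse.Mem q x

/-- `O` together with the images of its points in the interval `q`. -/
def expand (S : IntervalExchange ι) (q : ι) (O : Finset ℝ) : Finset ℝ :=
  O ∪ (O.filter (S.Mem q)).image (S.move q)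

/-- The image of `q` ends where `p` ends and is not longer than `p`. These two hypotheses recur
throughout the section. -/
theorem Mem.of_inverse_mem (hlen : S.len q ≤ S.len p)
    (hend : S.left p + S.len p = S.target q + S.len q) {x : ℝ}
    (h : S.inverse.Mem q x) : S.Mem p x := by
  simp only [Mem, inverse_left, inverse_len] at *
  constructor <;> linarith [h.1, h.2]

theorem not_inverse_mem_move {i : ι} (hi : i ≠ q) {x : ℝ} (h : S.Mem i x) :
    ¬ S.inverse.Mem q (S.move i x) := fun hq => hi (h.inverse_move.eq hq)

theorem restrict_mono {O V : Finset ℝ} (h : V ⊆ O) : S.restrict q V ⊆ S.restrict q O :=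
  Finset.filter_subset_filter _ h

theorem expand_mono {O V : Finset ℝ} (h : V ⊆ O) : S.expand q V ⊆ S.expand q O :=
  Finset.union_subset_union h (Finset.image_subset_image (Finset.filter_subset_filter _ h))

/-- A point in the image of `q` comes from a point of `q`. That point survives the restriction,
since the image of `q` lies inside `p`, which is disjoint from `q`. -/
theorem expand_restrict {O : Finset ℝ} (hO : S.IsInvariant O) (hpq : p ≠ q)
    (hlen : S.len q ≤ S.len p) (hend : S.left p + S.len p = S.target q + S.len q) :
    S.expand q (S.restrict q O) = O := by
  refine Finset.Subset.antisymm (fun x hx => ?_) fun x hx => ?_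
  · rcases Finset.mem_union.1 hx with hx | hx
    · exact (Finset.mem_filter.1 hx).1
    · obtain ⟨y, hy, rfl⟩ := Finset.mem_image.1 hx
      obtain ⟨hy, hyq⟩ := Finset.mem_filter.1 hy
      obtain ⟨i, hi, him⟩ := hO y (Finset.mem_filter.1 hy).1
      obtain rfl := hi.eq hyq
      exact him
  · by_cases hxq : S.inverse.Mem q x
    · obtain ⟨y, hy, i, hi, rfl⟩ := hO.exists_preimage hx
      obtain rfl := hi.inverse_move.eq hxq
      refine Finset.mem_union_right _ (Finset.mem_image_of_mem _ (Finset.mem_filter.2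
        ⟨Finset.mem_filter.2 ⟨hy, fun h => ?_⟩, hi⟩))
      exact hpq ((Mem.of_inverse_mem hlen hend h).eq hi)
    · exact Finset.mem_union_left _ (Finset.mem_filter.2 ⟨hx, hxq⟩)

theorem restrict_nonempty {O : Finset ℝ} (hO : S.IsInvariant O) (hne : O.Nonempty) (hpq : p ≠ q)
    (hlen : S.len q ≤ S.len p) (hend : S.left p + S.len p = S.target q + S.len q) :
    (S.restrict q O).Nonempty := by
  rw [Finset.nonempty_iff_ne_empty] at *
  intro h
  apply hne
  rw [← expand_restrict hO hpq hlen hend, h]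
  rfl

variable [DecidableEq ι]

/-- The end of the interval `p` that is the image of the interval `q` is removed, and the exchange
is replaced by the first return map to the rest. -/
@[simps] def cut (S : IntervalExchange ι) (p q : ι) (hpq : p ≠ q) (hlen : S.len q ≤ S.len p) :
    IntervalExchange ι where
  left := S.left
  target := Function.update S.target q (S.target p + S.len p - S.len q)
  len := Function.update S.len p (S.len p - S.len q)
  len_nonneg i := by
    by_cases h : i = p
    · subst h; simpa using hlen
    · simpa [h] using S.len_nonneg i
  left_sep i j h := by
    have hq := S.len_nonneg q
    have hs := S.left_sep i j h
    simp only [Function.update_apply]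
    split_ifs <;> subst_vars <;> first | exact hs | exact absurd rfl h | skip
    all_goals rcases hs with hs | hs <;> [left; right] <;> linarith
  target_sep i j h := by
    have hq := S.len_nonneg q
    have hs := S.target_sep i j h
    have hi := S.target_sep p i
    have hj := S.target_sep p j
    simp only [Function.update_apply]
    by_cases hip : i = p
    · subst hip
      by_cases hjq : j = q
      · subst hjq; left; simp [h]; linarith
      · simp only [hpq, hjq, h.symm, if_true, if_false]
        rcases hs with hs | hs <;> [left; right] <;> linarith
    by_cases hjp : j = p
    · subst hjp
      by_cases hiq : i = q
      · subst hiq; right; simp [h.symm]; linarith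
      · simp only [hpq, hiq, hip, if_true, if_false]
        rcases hs with hs | hs <;> [left; right] <;> linarith
    simp only [hip, hjp, if_false]
    split_ifs <;> subst_vars <;> first | exact hs | exact absurd rfl h | skip
    · rcases hj (Ne.symm hjp) with hs | hs <;> [left; right] <;> linarith
    · rcases hi (Ne.symm hip) with hs | hs <;> [right; left] <;> linarith

variable {hpq : p ≠ q} {hlen : S.len q ≤ S.len p}

theorem move_cut_of_ne {i : ι} (hi : i ≠ q) (x : ℝ) :
    (S.cut p q hpq hlen).move i x = S.move i x := by simp [move, hi]

theorem mem_cut_of_ne {i : ι} (hi : i ≠ p) (x : ℝ) :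
    (S.cut p q hpq hlen).Mem i x ↔ S.Mem i x := by simp [Mem, hi]

theorem mem_cut_self {x : ℝ} : (S.cut p q hpq hlen).Mem p x ↔
    S.left p < x ∧ x < S.left p + S.len p - S.len q := by
  simp [Mem, add_sub_assoc]

theorem move_cut (hend : S.left p + S.len p = S.target q + S.len q) (x : ℝ) :
    (S.cut p q hpq hlen).move q x = S.move p (S.move q x) := by
  simp [move]; linarith

theorem not_inverse_mem_of_cut_mem (hend : S.left p + S.len p = S.target q + S.len q) {i : ι}
    {x : ℝ} (h : (S.cut p q hpq hlen).Mem i x) : ¬ S.inverse.Mem q x := by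
  intro hq
  by_cases hi : i = p
  · subst hi
    rw [mem_cut_self] at h
    simp only [Mem, inverse_left, inverse_len] at hq
    linarith [h.1, h.2, hq.1, hq.2]
  · exact hi (((mem_cut_of_ne hi x).1 h).eq (Mem.of_inverse_mem hlen hend hq))

/-- Only the cut point `S.target q` itself is in doubt. It cannot belong to `O`: points of `O` have
preimages, so they lie in the open image of some interval, never at an end of the image of `q`. -/
theorem IsInvariant.mem_cut_self {O : Finset ℝ} (hO : S.IsInvariant O)
    (hend : S.left p + S.len p = S.target q + S.len q) {x : ℝ} (hx : x ∈ O) (hp : S.Mem p x)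
    (hxq : ¬ S.inverse.Mem q x) : (S.cut p q hpq hlen).Mem p x := by
  refine IntervalExchange.mem_cut_self.2 ⟨hp.1, ?_⟩
  obtain ⟨y, -, j, hj, rfl⟩ := hO.exists_preimage hx
  have hj := hj.inverse_move
  have hji : j ≠ q := fun h => hxq (h ▸ hj)
  have hi2 := hp.2
  by_contra hlt
  simp only [Mem, inverse_left, inverse_len, not_and, not_lt] at hxq hj hlt
  rcases S.target_sep j q hji with h | h <;>
    rcases lt_or_ge (S.target q) (S.move j y) with h' | h' <;>
    first | linarith [hxq h', hj.1, hj.2] | linarith [hj.1, hj.2]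

theorem IsInvariant.restrict {O : Finset ℝ} (hO : S.IsInvariant O)
    (hend : S.left p + S.len p = S.target q + S.len q) :
    (S.cut p q hpq hlen).IsInvariant (S.restrict q O) := by
  intro x hx
  obtain ⟨hx, hxq⟩ := Finset.mem_filter.1 hx
  obtain ⟨i, hi, him⟩ := hO x hx
  by_cases hiq : i = q
  · subst hiq
    obtain ⟨j, hj, hjm⟩ := hO _ him
    obtain rfl := (Mem.of_inverse_mem hlen hend hi.inverse_move).eq hj
    refine ⟨i, (mem_cut_of_ne hpq.symm x).2 hi, ?_⟩
    rw [move_cut hend]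
    exact Finset.mem_filter.2 ⟨hjm, not_inverse_mem_move hpq hj⟩
  · refine ⟨i, ?_, ?_⟩
    · by_cases hip : i = p
      · subst hip
        exact hO.mem_cut_self hend hx hi hxq
      · exact (mem_cut_of_ne hip x).2 hi
    · rw [move_cut_of_ne hiq]
      exact Finset.mem_filter.2 ⟨him, not_inverse_mem_move hiq hi⟩

theorem IsInvariant.expand {O : Finset ℝ} (hO : (S.cut p q hpq hlen).IsInvariant O)
    (hend : S.left p + S.len p = S.target q + S.len q) : S.IsInvariant (S.expand q O) := by
  intro x hx
  rcases Finset.mem_union.1 hx with hx | hx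
  · obtain ⟨i, hi, him⟩ := hO x hx
    have hiS : S.Mem i x := by
      by_cases hip : i = p
      · subst hip
        rw [IntervalExchange.mem_cut_self] at hi
        exact ⟨hi.1, by linarith [S.len_nonneg q, hi.2]⟩
      · exact (mem_cut_of_ne hip x).1 hi
    refine ⟨i, hiS, ?_⟩
    by_cases hiq : i = q
    · subst hiq
      exact Finset.mem_union_right _ (Finset.mem_image_of_mem _ (Finset.mem_filter.2 ⟨‹x ∈ O›, hiS⟩))
    · rw [move_cut_of_ne hiq] at him
      exact Finset.mem_union_left _ him
  · obtain ⟨y, hy, rfl⟩ := Finset.mem_image.1 hx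
    obtain ⟨hy, hyq⟩ := Finset.mem_filter.1 hy
    obtain ⟨i, hi, him⟩ := hO y hy
    obtain rfl := ((mem_cut_of_ne hpq.symm y).2 hyq).eq hi
    rw [move_cut hend] at him
    exact ⟨p, Mem.of_inverse_mem hlen hend hyq.inverse_move, Finset.mem_union_left _ him⟩

theorem restrict_expand {O : Finset ℝ} (hO : (S.cut p q hpq hlen).IsInvariant O)
    (hend : S.left p + S.len p = S.target q + S.len q) : S.restrict q (S.expand q O) = O := by
  refine Finset.Subset.antisymm (fun x hx => ?_) fun x hx => ?_
  · obtain ⟨hx, hxq⟩ := Finset.mem_filter.1 hx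
    rcases Finset.mem_union.1 hx with hx | hx
    · exact hx
    · obtain ⟨y, hy, rfl⟩ := Finset.mem_image.1 hx
      exact absurd (Finset.mem_filter.1 hy).2.inverse_move hxq
  · obtain ⟨i, hi, -⟩ := hO x hx
    exact Finset.mem_filter.2 ⟨Finset.mem_union_left _ hx, not_inverse_mem_of_cut_mem hend hi⟩

theorem IsOrbit.restrict {O : Finset ℝ} (hO : S.IsOrbit O)
    (hend : S.left p + S.len p = S.target q + S.len q) :
    (S.cut p q hpq hlen).IsOrbit (S.restrict q O) where
  nonempty := restrict_nonempty hO.invariant hO.nonempty hpq hlen hend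
  invariant := hO.invariant.restrict hend
  minimal V hV hne hinv := by
    have h := expand_mono (S := S) (q := q) hV
    rw [expand_restrict hO.invariant hpq hlen hend] at h
    rw [← hO.minimal _ h (hne.mono Finset.subset_union_left) (hinv.expand hend),
      restrict_expand hinv hend]

theorem IsOrbit.expand {O : Finset ℝ} (hO : (S.cut p q hpq hlen).IsOrbit O)
    (hend : S.left p + S.len p = S.target q + S.len q) : S.IsOrbit (S.expand q O) where
  nonempty := hO.nonempty.mono Finset.subset_union_left
  invariant := hO.invariant.expand hend
  minimal V hV hne hinv := by
    have h := restrict_mono (S := S) (q := q) hV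
    rw [restrict_expand hO.invariant hend] at h
    rw [← hO.minimal _ h (restrict_nonempty hinv hne hpq hlen hend) (hinv.restrict hend),
      expand_restrict hinv hpq hlen hend]

/-- The visits to `p` split into those outside the image of `q`, which remain in the shortened `p`,
and those inside it, which are as many as the visits to `q`. -/
theorem IsInvariant.visits_restrict {O : Finset ℝ} (hO : S.IsInvariant O)
    (hend : S.left p + S.len p = S.target q + S.len q) :
    S.visits O = Function.update ((S.cut p q hpq hlen).visits (S.restrict q O)) p
      ((S.cut p q hpq hlen).visits (S.restrict q O) p +
        (S.cut p q hpq hlen).visits (S.restrict q O) q) := by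
  have hne : ∀ i, i ≠ p → S.visits O i = (S.cut p q hpq hlen).visits (S.restrict q O) i := by
    intro i hi
    unfold visits
    congr 1
    ext x
    simp only [Finset.mem_filter, IntervalExchange.restrict, mem_cut_of_ne hi, and_assoc]
    refine and_congr_right fun _ => ⟨fun h => ⟨fun h' => hi ?_, h⟩, fun h => h.2⟩
    exact h.eq (Mem.of_inverse_mem hlen hend h')
  funext i
  by_cases hi : i = p
  · subst hi
    rw [Function.update_self, ← hne q hpq.symm, ← congrFun hO.visits_inverse q]
    simp only [visits, IntervalExchange.restrict]
    rw [← Finset.card_filter_add_card_filter_not (s := O.filter (S.Mem i)) (S.inverse.Mem q),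
      add_comm, Finset.filter_filter, Finset.filter_filter, Finset.filter_filter]
    congr 2 <;> ext x <;> simp only [Finset.mem_filter]
    · exact ⟨fun h => ⟨h.1, h.2.2, hO.mem_cut_self hend h.1 h.2.1 h.2.2⟩,
        fun h => ⟨h.1, ⟨h.2.2.1, by
          linarith [S.len_nonneg q, (IntervalExchange.mem_cut_self.1 h.2.2).2]⟩, h.2.1⟩⟩
    · exact ⟨fun h => ⟨h.1, h.2.2⟩, fun h => ⟨h.1, h.2.of_inverse_mem hlen hend, h.2⟩⟩
  · rw [Function.update_of_ne hi, hne i hi]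

/-- The numbers of visits transform like the lengths of the intervals. -/
theorem visitVectors_cut (S : IntervalExchange ι) {p q : ι} (hpq : p ≠ q)
    (hlen : S.len q ≤ S.len p) (hend : S.left p + S.len p = S.target q + S.len q) :
    S.visitVectors =
      (fun n => Function.update n p (n p + n q)) '' (S.cut p q hpq hlen).visitVectors := by
  ext n
  constructor
  · rintro ⟨O, hO, rfl⟩
    exact ⟨_, ⟨_, hO.restrict hend, rfl⟩, (hO.invariant.visits_restrict hend).symm⟩
  · rintro ⟨_, ⟨O, hO, rfl⟩, rfl⟩
    refine ⟨_, hO.expand hend, ?_⟩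
    rw [(hO.invariant.expand hend).visits_restrict hend, restrict_expand hO.invariant hend]

end Cut

end IntervalExchange

end

/-! ### Renormalization of the exchange of the double pentagon -/

noncomputable section

namespace IntervalExchange

variable {ι : Type*}

/-- The largest point of an orbit cannot move to the right. -/
theorem exists_target_le_left (S : IntervalExchange ι) {n : ι → ℕ} (hn : n ∈ S.visitVectors) :
    ∃ i, 0 < n i ∧ S.target i ≤ S.left i := by
  obtain ⟨O, hO, rfl⟩ := hn
  obtain ⟨i, hi, hm⟩ := hO.invariant _ (O.max'_mem hO.nonempty)
  refine ⟨i, Finset.card_pos.2 ⟨_, Finset.mem_filter.2 ⟨O.max'_mem hO.nonempty, hi⟩⟩, ?_⟩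
  have := O.le_max' _ hm
  simp only [move] at this
  linarith

variable [DecidableEq ι]

/-- The data of the new exchange are given as equations, so that chains of cuts can be evaluated by
`simp`. The two variants below cut an image instead of an interval, or at left ends, by conjugating
with `inverse` or `reflect`. -/
theorem exists_cut (S : IntervalExchange ι) {p q : ι} (hpq : p ≠ q)
    (hlen : S.len q ≤ S.len p) (hend : S.left p + S.len p = S.target q + S.len q) :
    ∃ T : IntervalExchange ι, T.left = S.left ∧
      T.target = Function.update S.target q (S.target p + S.len p - S.len q) ∧
      T.len = Function.update S.len p (S.len p - S.len q) ∧
      S.visitVectors = (fun n => Function.update n p (n p + n q)) '' T.visitVectors :=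
  ⟨S.cut p q hpq hlen, rfl, rfl, rfl, S.visitVectors_cut hpq hlen hend⟩

theorem exists_cut_inverse (S : IntervalExchange ι) {p q : ι} (hpq : p ≠ q)
    (hlen : S.len q ≤ S.len p) (hend : S.target p + S.len p = S.left q + S.len q) :
    ∃ T : IntervalExchange ι, T.left = Function.update S.left q (S.left p + S.len p - S.len q) ∧
      T.target = S.target ∧
      T.len = Function.update S.len p (S.len p - S.len q) ∧
      S.visitVectors = (fun n => Function.update n p (n p + n q)) '' T.visitVectors :=
  ⟨(S.inverse.cut p q hpq hlen).inverse, rfl, rfl, rfl, by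
    rw [← S.visitVectors_inverse, S.inverse.visitVectors_cut hpq hlen hend,
      visitVectors_inverse]⟩

theorem exists_cut_left (S : IntervalExchange ι) {p q : ι} (hpq : p ≠ q)
    (hlen : S.len q ≤ S.len p) (hstart : S.left p = S.target q) :
    ∃ T : IntervalExchange ι, T.left = Function.update S.left p (S.left p + S.len q) ∧
      T.target = Function.update (Function.update S.target p (S.target p + S.len q))
        q (S.target p) ∧
      T.len = Function.update S.len p (S.len p - S.len q) ∧
      S.visitVectors = (fun n => Function.update n p (n p + n q)) '' T.visitVectors := by
  obtain ⟨T, h₁, h₂, h₃, h₄⟩ := (S.reflect 0).exists_cut hpq hlen (by simp [hstart])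
  refine ⟨T.reflect 0, funext fun i => ?_, funext fun i => ?_, h₃, ?_⟩
  · by_cases hp : i = p
    · subst hp; simp [h₁, h₃]; ring
    · simp [h₁, h₃, hp]
  · by_cases hq : i = q
    · subst hq; simp [h₂, h₃, hpq.symm]
    · by_cases hp : i = p
      · subst hp; simp [h₂, h₃, hq]; ring
      · simp [h₂, h₃, hp, hq]
  · rw [visitVectors_reflect] at h₄ ⊢
    exact h₄

/-- Each point is fixed, so the orbits are singletons. This is the terminal case of the
renormalization. -/
theorem visitVectors_eq_of_fixed (S : IntervalExchange ι)
    (h : ∀ i, 0 < S.len i → S.target i = S.left i) :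
    S.visitVectors = {n | ∃ i, 0 < S.len i ∧ n = Pi.single i 1} := by
  have hinv {i : ι} {x : ℝ} (hi : S.Mem i x) : S.IsInvariant {x} := by
    intro y hy
    obtain rfl := Finset.mem_singleton.1 hy
    refine ⟨i, hi, ?_⟩
    rw [move, h i (by linarith [hi.1, hi.2])]
    simp
  have hvis {i : ι} {x : ℝ} (hi : S.Mem i x) : S.visits {x} = Pi.single i 1 := by
    funext j
    by_cases hj : j = i
    · subst hj; simp [visits, Finset.filter_singleton, hi]
    · have : ¬ S.Mem j x := fun hjx => hj (hjx.eq hi)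
      simp [visits, Finset.filter_singleton, this, hj]
  ext n
  constructor
  · rintro ⟨O, hO, rfl⟩
    obtain ⟨x, hx⟩ := hO.nonempty
    obtain ⟨i, hi, -⟩ := hO.invariant x hx
    rw [← hO.minimal {x} (by simpa using hx) (by simp) (hinv hi)]
    exact ⟨i, by linarith [hi.1, hi.2], hvis hi⟩
  · rintro ⟨i, hi, rfl⟩
    have hm : S.Mem i (S.left i + S.len i / 2) := ⟨by linarith, by linarith⟩
    refine ⟨{S.left i + S.len i / 2}, ⟨by simp, hinv hm, fun V hV hne _ => ?_⟩, hvis hm⟩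
    exact (Finset.subset_singleton_iff.1 hV).resolve_left hne.ne_empty

end IntervalExchange

namespace DoublePentagon

open Real

theorem goldenRatio_mul_self : goldenRatio * goldenRatio = goldenRatio + 1 := by
  rw [← sq, goldenRatio_sq]

instance : Fintype Roman := ⟨{.I, .II, .III, .IV}, by rintro (_ | _ | _ | _) <;> decide⟩

theorem sum_roman {α : Type*} [AddCommMonoid α] (f : Roman → α) :
    ∑ r, f r = f .I + f .II + f .III + f .IV := by
  change ∑ r ∈ {.I, .II, .III, .IV}, f r = _
  simp [add_assoc]

/-- The first return map to the sides 4 and 2 of the pentagon `up`. -/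
@[simps] def pentagonExchange (a b : ℝ) (ha : 0 ≤ a) (hb : 0 ≤ b) : IntervalExchange Roman where
  left
    | .I => 0
    | .II => goldenRatio * b
    | .III => goldenRatio * b + a
    | .IV => goldenRatio * b + a + b
  target
    | .I => a + goldenRatio * a
    | .II => 0
    | .III => a + goldenRatio * a + goldenRatio * b
    | .IV => a
  len
    | .I => goldenRatio * b
    | .II => a
    | .III => b
    | .IV => goldenRatio * a
  len_nonneg := by
    have := goldenRatio_pos
    rintro (_ | _ | _ | _) <;> positivity
  left_sep := by
    have h₁ : 0 ≤ goldenRatio * a := mul_nonneg goldenRatio_pos.le ha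
    have h₂ : 0 ≤ goldenRatio * b := mul_nonneg goldenRatio_pos.le hb
    rintro (_ | _ | _ | _) (_ | _ | _ | _) h <;> first | exact absurd rfl h | skip
    all_goals first | (left; dsimp only; linarith) | (right; dsimp only; linarith)
  target_sep := by
    have h₁ : 0 ≤ goldenRatio * a := mul_nonneg goldenRatio_pos.le ha
    have h₂ : 0 ≤ goldenRatio * b := mul_nonneg goldenRatio_pos.le hb
    rintro (_ | _ | _ | _) (_ | _ | _ | _) h <;> first | exact absurd rfl h | skip
    all_goals first | (left; dsimp only; linarith) | (right; dsimp only; linarith)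

/-- The linear map that relates short and long orbits. -/
def relate {α : Type*} [Add α] (n : Roman → α) : Roman → α
  | .I => n .I + n .III
  | .II => n .IV
  | .III => n .I
  | .IV => n .II + n .IV

/-- The exchange of `I` with `IV` and of `II` with `III`. -/
def Roman.mirror : Roman ≃ Roman where
  toFun | .I => .IV | .II => .III | .III => .II | .IV => .I
  invFun | .I => .IV | .II => .III | .III => .II | .IV => .I
  left_inv := by rintro (_ | _ | _ | _) <;> rfl
  right_inv := by rintro (_ | _ | _ | _) <;> rfl

/-- The exchange of `I` with `III` and of `II` with `IV`. -/
def Roman.halfTurn : Roman ≃ Roman where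
  toFun | .I => .III | .II => .IV | .III => .I | .IV => .II
  invFun | .I => .III | .II => .IV | .III => .I | .IV => .II
  left_inv := by rintro (_ | _ | _ | _) <;> rfl
  right_inv := by rintro (_ | _ | _ | _) <;> rfl

theorem pentagonExchange_mirror {a b : ℝ} (ha : 0 ≤ a) (hb : 0 ≤ b) :
    pentagonExchange b a hb ha =
      ((pentagonExchange a b ha hb).reflect ((goldenRatio + 1) * (a + b))).reindex Roman.mirror := by
  refine IntervalExchange.ext_data ?_ ?_ ?_ <;> rintro (_ | _ | _ | _) <;>
    simp [Roman.mirror] <;> ring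

theorem visitVectors_mirror {a b : ℝ} (ha : 0 ≤ a) (hb : 0 ≤ b) :
    (pentagonExchange b a hb ha).visitVectors =
      (fun n => n ∘ Roman.mirror) '' (pentagonExchange a b ha hb).visitVectors := by
  rw [pentagonExchange_mirror, IntervalExchange.visitVectors_reindex,
    IntervalExchange.visitVectors_reflect]

/-- The substitution that belongs to the outer part of the sector. -/
def outerSubst (n : Roman → ℕ) : Roman → ℕ
  | .I => n .I + n .II + n .IV
  | .II => n .II
  | .III => n .III + n .IV
  | .IV => n .IV

/-- The substitution that belongs to the inner part of the sector. -/
def innerSubst (n : Roman → ℕ) : Roman → ℕ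
  | .I => n .I + n .II + n .III + n .IV
  | .II => n .III + n .IV
  | .III => n .I + n .IV
  | .IV => n .I + n .II + n .IV

theorem visitVectors_outer {a b : ℝ} (ha : 0 ≤ a) (hb : 0 ≤ b) (h : 0 ≤ b - goldenRatio * a) :
    (pentagonExchange a b ha hb).visitVectors =
      outerSubst '' (pentagonExchange a (b - goldenRatio * a) ha h).visitVectors := by
  have hφ := goldenRatio_mul_self
  have hφ₀ := goldenRatio_pos
  have hφ₁ := one_lt_goldenRatio
  have hb' : goldenRatio * b = goldenRatio * (b - goldenRatio * a) + goldenRatio * a + a := by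
    linear_combination a * hφ
  have hφa := mul_nonneg hφ₀.le ha
  have hφb := mul_nonneg hφ₀.le h
  obtain ⟨S₁, l₁, t₁, n₁, v₁⟩ := (pentagonExchange a b ha hb).exists_cut_inverse
    (p := .III) (q := .IV) (by decide) (by simp; linarith) (by simp; ring)
  obtain ⟨S₂, l₂, t₂, n₂, v₂⟩ := S₁.exists_cut_left
    (p := .I) (q := .II) (by decide) (by simp [n₁]; linarith) (by simp [l₁, t₁])
  obtain ⟨S₃, l₃, t₃, n₃, v₃⟩ := S₂.exists_cut_left
    (p := .I) (q := .IV) (by decide) (by simp [n₁, n₂]; linarith) (by simp [l₁, t₁, l₂, t₂, n₁])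
  -- The cuts at left ends have moved the left end of the whole domain to a + φa. The two
  -- reflections compose to the translation that brings it back to 0.
  have hS : pentagonExchange a (b - goldenRatio * a) ha h =
      (S₃.reflect (a + goldenRatio * a)).reflect 0 := by
    refine IntervalExchange.ext_data ?_ ?_ ?_ <;> rintro (_ | _ | _ | _) <;>
      simp [l₁, l₂, l₃, t₁, t₂, t₃, n₁, n₂, n₃] <;> linarith
  rw [hS, IntervalExchange.visitVectors_reflect, IntervalExchange.visitVectors_reflect, v₁, v₂, v₃,
    Set.image_image, Set.image_image]
  refine Set.image_congr fun n _ => ?_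
  funext r
  rcases r with _ | _ | _ | _ <;> simp [outerSubst] <;> ring

theorem visitVectors_inner {a b : ℝ} (ha : 0 ≤ a) (hb : 0 ≤ b) (h₁ : 0 ≤ goldenRatio * a - b)
    (h₂ : 0 ≤ goldenRatio * (b - a)) :
    (pentagonExchange a b ha hb).visitVectors =
      innerSubst ''
        (pentagonExchange (goldenRatio * a - b) (goldenRatio * (b - a)) h₁ h₂).visitVectors := by
  have hφ := goldenRatio_mul_self
  have hφ₀ := goldenRatio_pos
  have hφ₁ := one_lt_goldenRatio
  -- With the old parameters expressed by the new ones, all conditions become linear in a', b', φa',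
  -- φb'.
  obtain ⟨a', ha'⟩ : ∃ a', a' = goldenRatio * a - b := ⟨_, rfl⟩
  obtain ⟨b', hb'⟩ : ∃ b', b' = goldenRatio * (b - a) := ⟨_, rfl⟩
  have ea : a = goldenRatio * a' + b' := by rw [ha', hb']; linear_combination (-a) * hφ
  have eb : b = goldenRatio * a' + goldenRatio * b' := by
    rw [ha', hb']; linear_combination (-b) * hφ
  have ea2 : goldenRatio * a = goldenRatio * a' + a' + goldenRatio * b' := by
    rw [ea]; linear_combination a' * hφ
  have eb2 : goldenRatio * b = goldenRatio * a' + a' + goldenRatio * b' + b' := by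
    rw [eb]; linear_combination (a' + b') * hφ
  simp only [← ha', ← hb'] at h₁ h₂ ⊢
  have hφa := mul_nonneg hφ₀.le h₁
  have hφb := mul_nonneg hφ₀.le h₂
  obtain ⟨S₁, l₁, t₁, n₁, v₁⟩ := (pentagonExchange a b ha hb).exists_cut
    (p := .IV) (q := .III) (by decide) (by simp; linarith) (by simp; ring)
  obtain ⟨S₂, l₂, t₂, n₂, v₂⟩ := S₁.exists_cut_inverse
    (p := .I) (q := .IV) (by decide) (by simp [n₁]; linarith) (by simp [l₁, t₁, n₁]; linarith)
  obtain ⟨S₃, l₃, t₃, n₃, v₃⟩ := S₂.exists_cut_inverse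
    (p := .I) (q := .III) (by decide) (by simp [n₁, n₂]; linarith)
    (by simp [l₁, t₁, n₁, l₂, t₂, n₂]; linarith)
  obtain ⟨S₄, l₄, t₄, n₄, v₄⟩ := S₃.exists_cut
    (p := .II) (q := .I) (by decide) (by simp [n₁, n₂, n₃]; linarith)
    (by simp [l₁, t₁, n₁, l₂, t₂, n₂, l₃, t₃, n₃]; linarith)
  obtain ⟨S₅, l₅, t₅, n₅, v₅⟩ := S₄.exists_cut_inverse
    (p := .III) (q := .II) (by decide) (by simp [n₁, n₂, n₃, n₄]; linarith)
    (by simp [l₁, t₁, n₁, l₂, t₂, n₂, l₃, t₃, n₃, l₄, t₄, n₄]; linarith)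
  -- Five cuts reproduce the family only up to inversion, reflection and the relabelling
  -- `Roman.halfTurn`.
  have hS : pentagonExchange a' b' h₁ h₂ =
      (S₅.inverse.reflect ((goldenRatio + 1) * (a' + b'))).reindex Roman.halfTurn := by
    refine IntervalExchange.ext_data ?_ ?_ ?_ <;> rintro (_ | _ | _ | _) <;>
      simp [Roman.halfTurn, l₁, l₂, l₃, l₄, l₅, t₁, t₂, t₃, t₄, t₅, n₁, n₂, n₃, n₄, n₅] <;> linarith
  rw [hS, IntervalExchange.visitVectors_reindex, IntervalExchange.visitVectors_reflect,
    IntervalExchange.visitVectors_inverse, v₁, v₂, v₃, v₄, v₅,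
    Set.image_image, Set.image_image, Set.image_image, Set.image_image, Set.image_image]
  refine Set.image_congr fun n _ => ?_
  funext r
  rcases r with _ | _ | _ | _ <;> simp [innerSubst, Roman.halfTurn] <;> ring

/-- Since M² = M + I, `relate` plays the role of multiplication by φ. The changes of (a, b) have
coefficients in ℤ[φ], and the substitutions are linear for this multiplication. -/
theorem outerSubst_relate (n : Roman → ℕ) : outerSubst (relate n) = relate (outerSubst n) := by
  funext r
  rcases r with _ | _ | _ | _ <;> simp [outerSubst, relate] <;> ring

theorem innerSubst_relate (n : Roman → ℕ) : innerSubst (relate n) = relate (innerSubst n) := by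
  funext r
  rcases r with _ | _ | _ | _ <;> simp [innerSubst, relate] <;> ring

theorem mirror_relate (n : Roman → ℕ) :
    relate n ∘ Roman.mirror = relate (n ∘ Roman.mirror) := by
  funext r
  rcases r with _ | _ | _ | _ <;> simp [Roman.mirror, relate, add_comm]

theorem exists_visitVectors_eq_of_image {V W : Set (Roman → ℕ)} {f : (Roman → ℕ) → Roman → ℕ}
    (hf : ∀ n, f (relate n) = relate (f n)) (hV : V = f '' W) (hW : ∃ v, W = {v, relate v}) :
    ∃ v, V = {v, relate v} := by
  obtain ⟨v, rfl⟩ := hW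
  exact ⟨f v, by rw [hV, Set.image_pair, hf]⟩

theorem visitVectors_of_left_eq_zero {b : ℝ} (hb : 0 < b) :
    (pentagonExchange 0 b le_rfl hb.le).visitVectors =
      {Pi.single .III 1, relate (Pi.single .III 1)} := by
  have hφb := mul_pos goldenRatio_pos hb
  have h : relate (Pi.single .III 1 : Roman → ℕ) = Pi.single .I 1 := by
    funext r; rcases r with _ | _ | _ | _ <;> rfl
  rw [h, IntervalExchange.visitVectors_eq_of_fixed]
  · ext n
    constructor
    · rintro ⟨_ | _ | _ | _, hr, rfl⟩ <;> simp at hr ⊢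
    · rintro (rfl | rfl)
      · exact ⟨.III, hb, rfl⟩
      · exact ⟨.I, hφb, rfl⟩
  · rintro (_ | _ | _ | _) hr <;> simp at hr ⊢

/-- Strong induction on the total number of visits of one orbit; the existence of a periodic orbit
is what makes the renormalization terminate. -/
theorem exists_visitVectors_eq_aux (N : ℕ) : ∀ (a b : ℝ) (ha : 0 ≤ a) (hb : 0 ≤ b),
    ¬ (a = 0 ∧ b = 0) → a ≤ b →
    ∀ n ∈ (pentagonExchange a b ha hb).visitVectors, ∑ r, n r = N →
    ∃ v, (pentagonExchange a b ha hb).visitVectors = {v, relate v} := by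
  induction N using Nat.strong_induction_on with
  | _ N ih =>
  have ih' : ∀ (a b : ℝ) (ha : 0 ≤ a) (hb : 0 ≤ b), ¬ (a = 0 ∧ b = 0) →
      ∀ n ∈ (pentagonExchange a b ha hb).visitVectors, ∑ r, n r < N →
      ∃ v, (pentagonExchange a b ha hb).visitVectors = {v, relate v} := by
    intro a b ha hb hab n hn hlt
    rcases le_total a b with h | h
    · exact ih _ hlt a b ha hb hab h n hn rfl
    · refine exists_visitVectors_eq_of_image (f := fun n => n ∘ Roman.mirror) mirror_relate
        (visitVectors_mirror hb ha) ?_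
      refine ih _ hlt b a hb ha (fun h => hab h.symm) h (n ∘ Roman.mirror) ?_
        (Equiv.sum_comp Roman.mirror n)
      rw [visitVectors_mirror ha hb]
      exact ⟨n, hn, rfl⟩
  intro a b ha hb hab hle n hn hN
  rcases ha.eq_or_lt with rfl | ha₀
  · exact ⟨_, visitVectors_of_left_eq_zero (hb.lt_of_ne fun h => hab ⟨rfl, h.symm⟩)⟩
  have hφ₀ := goldenRatio_pos
  rcases le_total (goldenRatio * a) b with h | h
  · have h := sub_nonneg.2 h
    have hV := visitVectors_outer ha hb h
    refine exists_visitVectors_eq_of_image outerSubst_relate hV ?_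
    -- For a > 0 the intervals I and III move to the right, so every orbit visits II or IV, and
    -- undoing `outerSubst` removes visits.
    have hpos : 0 < n .II + n .IV := by
      obtain ⟨i, hi, hle⟩ := IntervalExchange.exists_target_le_left _ hn
      have := mul_pos hφ₀ ha₀
      rcases i with _ | _ | _ | _ <;> simp at hle <;> first | omega | linarith
    rw [hV] at hn
    obtain ⟨m, hm, rfl⟩ := hn
    refine ih' _ _ _ _ (fun h => ha₀.ne' h.1) m hm ?_
    rw [← hN]
    simp only [sum_roman, outerSubst] at hpos ⊢
    omega
  · have h₁ := sub_nonneg.2 h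
    have h₂ := mul_nonneg hφ₀.le (sub_nonneg.2 hle)
    have hV := visitVectors_inner ha hb h₁ h₂
    refine exists_visitVectors_eq_of_image innerSubst_relate hV ?_
    obtain ⟨i, hi, -⟩ := IntervalExchange.exists_target_le_left _ hn
    have hpos : 0 < ∑ r, n r := hi.trans_le (Finset.single_le_sum (by simp) (Finset.mem_univ i))
    rw [hV] at hn
    obtain ⟨m, hm, rfl⟩ := hn
    refine ih' _ _ _ _ (fun h => ?_) m hm ?_
    · have hba := (mul_eq_zero.1 h.2).resolve_left hφ₀.ne'
      have := mul_pos (sub_pos.2 one_lt_goldenRatio) ha₀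
      linarith [h.1]
    · rw [← hN]
      simp only [sum_roman, innerSubst] at hpos ⊢
      -- `innerSubst` at least doubles the total.
      omega

theorem exists_visitVectors_eq {a b : ℝ} (ha : 0 ≤ a) (hb : 0 ≤ b) (hab : ¬ (a = 0 ∧ b = 0))
    (hne : (pentagonExchange a b ha hb).visitVectors.Nonempty) :
    ∃ v, (pentagonExchange a b ha hb).visitVectors = {v, relate v} := by
  obtain ⟨n, hn⟩ := hne
  rcases le_total a b with h | h
  · exact exists_visitVectors_eq_aux _ a b ha hb hab h n hn rfl
  · refine exists_visitVectors_eq_of_image (f := fun n => n ∘ Roman.mirror) mirror_relate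
      (visitVectors_mirror hb ha) ?_
    refine exists_visitVectors_eq_aux _ b a hb ha (fun h => hab h.symm) h (n ∘ Roman.mirror) ?_ rfl
    rw [visitVectors_mirror ha hb]
    exact ⟨n, hn, rfl⟩

end DoublePentagon

end

/-! ### Geometry of the pentagon and of a single step -/

noncomputable section

namespace DoublePentagon

open Real

theorem cos_two_pi_div_five : cos (2 * π / 5) = (goldenRatio - 1) / 2 := by
  have h : (2 * π / 5) = 2 * (π / 5) := by ring
  have h5 : √5 * √5 = 5 := mul_self_sqrt (by norm_num)
  rw [h, cos_two_mul, cos_pi_div_five, goldenRatio]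
  linear_combination h5 / 8

theorem sin_two_pi_div_five_pos : 0 < sin (2 * π / 5) :=
  sin_pos_of_pos_of_lt_pi (by positivity) (by linarith [pi_pos])

theorem sin_two_pi_div_five_mul_self :
    sin (2 * π / 5) * sin (2 * π / 5) = (2 + goldenRatio) / 4 := by
  have h := sin_sq_add_cos_sq (2 * π / 5)
  rw [cos_two_pi_div_five] at h
  linear_combination h - goldenRatio_mul_self / 4

theorem cos_four_pi_div_five : cos (4 * π / 5) = -(goldenRatio / 2) := by
  have h : (4 * π / 5) = 2 * (2 * π / 5) := by ring
  rw [h, cos_two_mul, cos_two_pi_div_five]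
  linear_combination goldenRatio_mul_self / 2

theorem sin_four_pi_div_five : sin (4 * π / 5) = sin (2 * π / 5) * (goldenRatio - 1) := by
  have h : (4 * π / 5) = 2 * (2 * π / 5) := by ring
  rw [h, sin_two_mul, cos_two_pi_div_five]
  ring

theorem Side.normal_re_eq (s : Side) : s.normal.re = sin (s.angle + π / 2) := by
  rw [Side.normal, Complex.exp_ofReal_mul_I_re, sin_add_pi_div_two]

theorem Side.normal_im_eq (s : Side) : s.normal.im = -cos (s.angle + π / 2) := by
  rw [Side.normal, Complex.exp_ofReal_mul_I_im, cos_add_pi_div_two, neg_neg]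

theorem Side.normal_re (s : Side) : s.normal.re = match s with
    | .s1 => -sin (2 * π / 5)
    | .s2 => sin (2 * π / 5) * (goldenRatio - 1)
    | .s3 => 0
    | .s4 => -(sin (2 * π / 5) * (goldenRatio - 1))
    | .s5 => sin (2 * π / 5) := by
  rw [Side.normal_re_eq, ← sin_four_pi_div_five]
  rcases s with _ | _ | _ | _ | _ <;> simp only [Side.angle]
  · rw [← sin_two_pi_sub]; congr 1; ring
  · congr 1; ring
  · simp
  · rw [← sin_two_pi_sub]; congr 1; ring
  · congr 1; ring

theorem Side.normal_im (s : Side) : s.normal.im = match s with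
    | .s1 => -((goldenRatio - 1) / 2)
    | .s2 => goldenRatio / 2
    | .s3 => -1
    | .s4 => goldenRatio / 2
    | .s5 => -((goldenRatio - 1) / 2) := by
  have h : goldenRatio / 2 = -cos (4 * π / 5) := by rw [cos_four_pi_div_five, neg_neg]
  rw [Side.normal_im_eq, ← cos_two_pi_div_five, h]
  rcases s with _ | _ | _ | _ | _ <;> simp only [Side.angle, neg_inj]
  · rw [← cos_two_pi_sub]; congr 1; ring
  · congr 1; ring
  · simp
  · rw [← cos_two_pi_sub]; congr 1; ring
  · congr 1; ring

theorem Side.normal_normSq (s : Side) :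
    s.normal.re * s.normal.re + s.normal.im * s.normal.im = 1 := by
  rw [Side.normal_re_eq, Side.normal_im_eq]
  linear_combination sin_sq_add_cos_sq (s.angle + π / 2)

/-- Half of the length of a side. -/
def halfSide : ℝ := 2 * sin (2 * π / 5) * (2 - goldenRatio)

/-- The irrational factor sin 72° disappears from the product; this keeps the later comparisons
linear over ℚ(φ). -/
theorem sin_mul_halfSide : sin (2 * π / 5) * halfSide = (3 - goldenRatio) / 2 := by
  unfold halfSide
  linear_combination 2 * (2 - goldenRatio) * sin_two_pi_div_five_mul_self - goldenRatio_mul_self / 2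

theorem halfSide_pos : 0 < halfSide :=
  mul_pos (mul_pos two_pos sin_two_pi_div_five_pos) (sub_pos.2 goldenRatio_lt_two)

theorem inner_eq (z w : ℂ) : inner ℝ z w = z.re * w.re + z.im * w.im := by
  simp [Complex.inner]; ring

/-- The point of the line through a side at the signed distance `τ` from the midpoint. -/
def Side.pointAt (s : Side) (τ : ℝ) : ℂ := s.normal * (1 + τ * Complex.I)

theorem Side.pointAt_re (s : Side) (τ : ℝ) :
    (s.pointAt τ).re = s.normal.re - τ * s.normal.im := by
  simp [Side.pointAt]; ring

theorem Side.pointAt_im (s : Side) (τ : ℝ) :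
    (s.pointAt τ).im = s.normal.im + τ * s.normal.re := by
  simp [Side.pointAt]; ring

theorem abs_lt_halfSide_iff {τ : ℝ} : |τ| < halfSide ↔
    -((3 - goldenRatio) / 2) < sin (2 * π / 5) * τ ∧
      sin (2 * π / 5) * τ < (3 - goldenRatio) / 2 := by
  have h := sin_two_pi_div_five_pos
  rw [← sin_mul_halfSide, ← mul_neg, mul_lt_mul_iff_right₀ h, mul_lt_mul_iff_right₀ h, abs_lt]

theorem inner_pointAt_lt_one_iff (s : Side) (τ : ℝ) :
    (∀ s' : Side, s' ≠ s → inner ℝ s'.normal (s.pointAt τ) < 1) ↔ |τ| < halfSide := by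
  rw [abs_lt_halfSide_iff]
  simp only [inner_eq, Side.pointAt_re, Side.pointAt_im]
  have hg := goldenRatio_mul_self
  have hg₁ := one_lt_goldenRatio
  have hg₂ := goldenRatio_lt_two
  have hs := sin_two_pi_div_five_mul_self
  have e₁ := Side.normal_re
  have e₂ := Side.normal_im
  generalize sin (2 * π / 5) = x at *
  generalize goldenRatio = g at *
  have m₁ : x * x * g = (3 * g + 1) / 4 := by linear_combination g * hs + hg / 4
  have m₂ : x * x * g * g = (4 * g + 3) / 4 := by linear_combination g * m₁ + 3 / 4 * hg
  have m₃ : x * τ * g * g = x * τ * g + x * τ := by linear_combination x * τ * hg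
  constructor
  · intro h
    have h₁ := h .s1
    have h₂ := h .s2
    have h₃ := h .s3
    have h₄ := h .s4
    have h₅ := h .s5
    simp only [e₁, e₂] at h₁ h₂ h₃ h₄ h₅
    rcases s with _ | _ | _ | _ | _ <;> simp at h₁ h₂ h₃ h₄ h₅ <;> constructor <;> linarith
  · rintro ⟨h₁, h₂⟩
    -- These products bound the terms in `x * τ * g` that occur for some pairs of sides.
    have h₃ := mul_lt_mul_of_pos_right h₁ (sub_pos.2 hg₁)
    have h₄ := mul_lt_mul_of_pos_right h₂ (sub_pos.2 hg₁)
    rintro s' hs'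
    rw [e₁, e₂, e₁, e₂]
    rcases s with _ | _ | _ | _ | _ <;> rcases s' with _ | _ | _ | _ | _ <;>
      first | exact absurd rfl hs' | (dsimp only; linarith)

theorem Copy.sign_mul_self (c : Copy) : c.sign * c.sign = 1 := by
  rcases c <;> simp [Copy.sign]

theorem Copy.sign_other (c : Copy) : c.other.sign = -c.sign := by
  rcases c <;> simp [Copy.sign, Copy.other]

theorem mem_openSide_iff {c : Copy} {s : Side} {z : ℂ} :
    z ∈ c.openSide s ↔ ∃ τ : ℝ, |τ| < halfSide ∧ z = c.sign * s.pointAt τ := by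
  have hσ := c.sign_mul_self
  have hσ' : (c.sign : ℂ) * c.sign = 1 := by exact_mod_cast hσ
  have hn := s.normal_normSq
  constructor
  · rintro ⟨h₁, h₂⟩
    obtain ⟨w, rfl⟩ : ∃ w, z = c.sign * w := ⟨c.sign * z, by rw [← mul_assoc, hσ', one_mul]⟩
    rw [← mul_assoc, hσ', one_mul] at h₁ h₂
    -- This expands `w` in the orthonormal basis formed by the normal and its quarter turn; the
    -- first coefficient is 1 by `h₁`.
    have hw : w = s.pointAt (s.normal.re * w.im - s.normal.im * w.re) := by
      rw [inner_eq] at h₁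
      apply Complex.ext
      · rw [Side.pointAt_re]; linear_combination (-w.re) * hn + s.normal.re * h₁
      · rw [Side.pointAt_im]; linear_combination (-w.im) * hn + s.normal.im * h₁
    refine ⟨_, (inner_pointAt_lt_one_iff s _).1 ?_, congrArg _ hw⟩
    rwa [← hw]
  · rintro ⟨τ, hτ, rfl⟩
    rw [← inner_pointAt_lt_one_iff s] at hτ
    simp only [Copy.openSide, Set.mem_ofPred_eq, ← mul_assoc, hσ', one_mul]
    refine ⟨?_, hτ⟩
    rw [inner_eq, Side.pointAt_re, Side.pointAt_im]
    linear_combination hn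

/-- A linear coordinate that is constant on the trajectories of direction `θ`. -/
def offset (θ : ℝ) (z : ℂ) : ℝ := z.re * sin θ - z.im * cos θ

/-- The component of the normal of a side in the direction `θ`. -/
def Side.slope (θ : ℝ) (s : Side) : ℝ := inner ℝ s.normal (dir θ)

theorem dir_re (θ : ℝ) : (dir θ).re = cos θ := Complex.exp_ofReal_mul_I_re θ

theorem dir_im (θ : ℝ) : (dir θ).im = sin θ := Complex.exp_ofReal_mul_I_im θ

theorem Side.slope_eq (θ : ℝ) (s : Side) :
    s.slope θ = s.normal.re * cos θ + s.normal.im * sin θ := by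
  rw [Side.slope, inner_eq, dir_re, dir_im]

theorem offset_add_mul_dir (θ r : ℝ) (z : ℂ) : offset θ (z + r * dir θ) = offset θ z := by
  simp [offset, dir_re, dir_im]; ring

theorem offset_pointAt (θ : ℝ) (c : Copy) (s : Side) (τ : ℝ) :
    offset θ (c.sign * s.pointAt τ) = c.sign * (offset θ s.normal - τ * s.slope θ) := by
  simp [offset, Side.slope_eq, Side.pointAt_re, Side.pointAt_im]; ring

theorem offset_entry (θ : ℝ) (a : Crossing) :
    offset θ a.entry = offset θ a.point - 2 * a.copy.sign * offset θ a.side.normal := by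
  simp [offset, Crossing.entry]; ring

theorem abs_offset_sub_lt {θ : ℝ} {c : Copy} {s : Side} {z : ℂ} (hz : z ∈ c.openSide s)
    (hs : 0 < c.sign * s.slope θ) :
    |offset θ z - c.sign * offset θ s.normal| < halfSide * (c.sign * s.slope θ) := by
  obtain ⟨τ, hτ, rfl⟩ := mem_openSide_iff.1 hz
  rw [offset_pointAt, show c.sign * (offset θ s.normal - τ * s.slope θ) -
    c.sign * offset θ s.normal = -(τ * (c.sign * s.slope θ)) by ring, abs_neg, abs_mul,
    abs_of_pos hs]
  exact mul_lt_mul_of_pos_right hτ hs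

/-- Together with `abs_offset_sub_lt` and `eq_of_offset_eq`: `offset` identifies an open exit side
with an open interval. -/
theorem exists_mem_openSide {θ : ℝ} {c : Copy} {s : Side} (hs : 0 < c.sign * s.slope θ) {x : ℝ}
    (hx : |x - c.sign * offset θ s.normal| < halfSide * (c.sign * s.slope θ)) :
    ∃ z ∈ c.openSide s, offset θ z = x := by
  refine ⟨_, mem_openSide_iff.2
    ⟨-(x - c.sign * offset θ s.normal) / (c.sign * s.slope θ), ?_, rfl⟩, ?_⟩
  · rwa [abs_div, abs_neg, abs_of_pos hs, div_lt_iff₀ hs]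
  · rw [offset_pointAt, mul_sub, mul_left_comm, div_mul_cancel₀ _ hs.ne']
    ring

theorem eq_of_offset_eq {θ : ℝ} {c : Copy} {s : Side} {z w : ℂ} (hz : z ∈ c.openSide s)
    (hw : w ∈ c.openSide s) (hs : 0 < c.sign * s.slope θ) (h : offset θ z = offset θ w) :
    z = w := by
  obtain ⟨τ, -, rfl⟩ := mem_openSide_iff.1 hz
  obtain ⟨τ', -, rfl⟩ := mem_openSide_iff.1 hw
  rw [offset_pointAt, offset_pointAt] at h
  have : (τ - τ') * (c.sign * s.slope θ) = 0 := by linear_combination -h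
  rw [sub_eq_zero.1 ((mul_eq_zero.1 this).resolve_right hs.ne')]

theorem entry_mem_openSide {a : Crossing} (ha : a.point ∈ a.copy.openSide a.side) :
    a.entry ∈ a.copy.other.openSide a.side := by
  obtain ⟨τ, hτ, h⟩ := mem_openSide_iff.1 ha
  refine mem_openSide_iff.2 ⟨-τ, by rwa [abs_neg], ?_⟩
  rw [Crossing.entry, h, Copy.sign_other]
  simp only [Side.pointAt]
  push_cast
  ring

theorem inner_sign_mul_add (θ r : ℝ) (c : Copy) (s : Side) (z : ℂ) :
    inner ℝ s.normal ((c.sign : ℂ) * (z + r * dir θ)) =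
      inner ℝ s.normal ((c.sign : ℂ) * z) + r * (c.sign * s.slope θ) := by
  simp [Side.slope_eq, dir_re, dir_im]; ring

theorem mem_openSide_inner {c : Copy} {s s' : Side} {z : ℂ} (h : z ∈ c.openSide s) :
    inner ℝ s'.normal ((c.sign : ℂ) * z) ≤ 1 := by
  by_cases hs : s' = s
  · subst hs; exact h.1.le
  · exact (h.2 s' hs).le

theorem eq_of_mem_openSide {c : Copy} {s s' : Side} {z : ℂ} (h : z ∈ c.openSide s)
    (h' : inner ℝ s'.normal ((c.sign : ℂ) * z) = 1) : s' = s := by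
  by_contra hs
  exact (h.2 s' hs).ne h'

/-- The geometry of a step: the trajectory leaves through both sides, and the offset is kept. -/
theorem step_iff {θ : ℝ} {a b : Crossing} (ha : a.point ∈ a.copy.openSide a.side)
    (hb : b.point ∈ b.copy.openSide b.side) :
    Step θ a b ↔ b.copy = a.copy.other ∧ 0 < a.copy.sign * a.side.slope θ ∧
      0 < b.copy.sign * b.side.slope θ ∧
      offset θ b.point = offset θ a.point - 2 * a.copy.sign * offset θ a.side.normal := by
  rw [← offset_entry, Step, and_congr_right_iff]
  intro hc
  have he := entry_mem_openSide ha
  rw [← hc] at he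
  have hsign : b.copy.sign = -a.copy.sign := by rw [hc, Copy.sign_other]
  constructor
  · rintro ⟨t, ht, hbt, hint⟩
    -- The function bounding each half-plane is affine along the trajectory. It is 1 at an end lying
    -- on the side and less than 1 at the middle, which fixes the sign of its slope.
    have hmid := hint (t / 2) (by linarith) (by linarith)
    refine ⟨?_, ?_, by rw [hbt, offset_add_mul_dir]⟩
    · have h := hmid a.side
      rw [inner_sign_mul_add, he.1, hsign] at h
      by_contra hneg
      nlinarith
    · have h := hmid b.side
      have h' := hb.1
      rw [hbt] at h'
      rw [inner_sign_mul_add] at h h'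
      by_contra hneg
      nlinarith
  · rintro ⟨has, hbs, hoff⟩
    have hne : b.side ≠ a.side := by
      rintro h
      rw [h, hsign] at hbs
      linarith
    -- `t` is the component of the displacement along `dir θ`; the other component vanishes because
    -- the offsets agree.
    obtain ⟨t, ht⟩ : ∃ t : ℝ, b.point = a.entry + t * dir θ := by
      refine ⟨(b.point.re - a.entry.re) * cos θ + (b.point.im - a.entry.im) * sin θ, ?_⟩
      have h₁ := sin_sq_add_cos_sq θ
      simp only [offset] at hoff
      apply Complex.ext <;> simp only [Complex.add_re, Complex.add_im, Complex.re_ofReal_mul,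
        Complex.im_ofReal_mul, dir_re, dir_im]
      · linear_combination (-(b.point.re - a.entry.re)) * h₁ + sin θ * hoff
      · linear_combination (-(b.point.im - a.entry.im)) * h₁ - cos θ * hoff
    have hin (s : Side) := inner_sign_mul_add θ t b.copy s a.entry
    rw [← ht] at hin
    have ht₀ : 0 < t := by
      have h₁ := hin b.side
      rw [hb.1] at h₁
      have h₂ := he.2 b.side hne
      by_contra hneg
      nlinarith
    refine ⟨t, ht₀, ht, fun r hr hrt s => ?_⟩
    rw [inner_sign_mul_add]
    have h₁ := hin s
    have h₂ := mem_openSide_inner (s' := s) he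
    have h₃ := mem_openSide_inner (s' := s) hb
    -- An affine function that is at most 1 at both ends, and less than 1 at one of them, is less
    -- than 1 in between. The strict end is the exit for the entry side and the entry for all other
    -- sides.
    rcases h₂.eq_or_lt with h | h
    · obtain rfl := eq_of_mem_openSide he h
      have h₄ := hb.2 a.side hne.symm
      rw [h₁] at h₄
      rw [h] at h₄ ⊢
      have : b.copy.sign * a.side.slope θ < 0 := by
        by_contra hneg
        nlinarith
      nlinarith
    · have h5 : (t - r) * inner ℝ s.normal ((b.copy.sign : ℂ) * a.entry) < (t - r) * 1 :=
        mul_lt_mul_of_pos_left h (by linarith)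
      have h6 : r * inner ℝ s.normal ((b.copy.sign : ℂ) * b.point) ≤ r * 1 :=
        mul_le_mul_of_nonneg_left h₃ hr.le
      rw [h₁] at h6
      refine lt_of_mul_lt_mul_left (a := t) ?_ ht₀.le
      linarith

end DoublePentagon

end

/-! ### The first return map is `pentagonExchange` -/

noncomputable section

namespace DoublePentagon

open Real

/-- The width of the side 1 in the coordinate `offset θ`. -/
def widthOne (θ : ℝ) : ℝ := 2 * halfSide * sin (2 * π / 5 + θ)

/-- The width of the side 5 in the coordinate `offset θ`. -/
def widthFive (θ : ℝ) : ℝ := 2 * halfSide * sin (θ - 2 * π / 5)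

theorem widthOne_eq (θ : ℝ) : widthOne θ = (3 - goldenRatio) * cos θ +
    2 * sin (2 * π / 5) * (2 * goldenRatio - 3) * sin θ := by
  rw [widthOne, sin_add, cos_two_pi_div_five]
  have hg := goldenRatio_mul_self
  have h := sin_mul_halfSide
  have h' : halfSide = 2 * sin (2 * π / 5) * (2 - goldenRatio) := rfl
  generalize sin (2 * π / 5) = x at *
  generalize goldenRatio = g at *
  linear_combination 2 * cos θ * h + (g - 1) * sin θ * h' - 2 * x * sin θ * hg

theorem widthFive_eq (θ : ℝ) : widthFive θ =
    2 * sin (2 * π / 5) * (2 * goldenRatio - 3) * sin θ - (3 - goldenRatio) * cos θ := by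
  rw [widthFive, sin_sub, cos_two_pi_div_five]
  have hg := goldenRatio_mul_self
  have h := sin_mul_halfSide
  have h' : halfSide = 2 * sin (2 * π / 5) * (2 - goldenRatio) := rfl
  generalize sin (2 * π / 5) = x at *
  generalize goldenRatio = g at *
  linear_combination -2 * cos θ * h + (g - 1) * sin θ * h' - 2 * x * sin θ * hg

theorem widthOne_nonneg {θ : ℝ} (hθ : θ ∈ thirdSector) : 0 ≤ widthOne θ := by
  refine mul_nonneg (by linarith [halfSide_pos]) (sin_nonneg_of_nonneg_of_le_pi ?_ ?_) <;>
    linarith [hθ.1, hθ.2, pi_pos]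

theorem widthFive_nonneg {θ : ℝ} (hθ : θ ∈ thirdSector) : 0 ≤ widthFive θ := by
  refine mul_nonneg (by linarith [halfSide_pos]) (sin_nonneg_of_nonneg_of_le_pi ?_ ?_) <;>
    linarith [hθ.1, hθ.2, pi_pos]

theorem width_ne_zero {θ : ℝ} (hθ : θ ∈ thirdSector) : ¬ (widthOne θ = 0 ∧ widthFive θ = 0) := by
  rintro ⟨h₁, h₂⟩
  have hs : 0 < sin θ := sin_pos_of_pos_of_lt_pi (by linarith [hθ.1, pi_pos])
    (by linarith [hθ.2, pi_pos])
  rw [widthOne_eq] at h₁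
  rw [widthFive_eq] at h₂
  have hg : 0 < 2 * goldenRatio - 3 := by nlinarith [goldenRatio_mul_self, one_lt_goldenRatio]
  have := mul_pos (mul_pos sin_two_pi_div_five_pos hg) hs
  linarith

/-- These are the signed projected widths of the sides; with a, b ≥ 0 their signs show which sides
are exits of `up` and which of `down`. -/
theorem halfSide_mul_slope (θ : ℝ) (s : Side) : 2 * (halfSide * s.slope θ) = match s with
    | .s1 => -widthOne θ
    | .s2 => goldenRatio * widthOne θ + widthFive θ
    | .s3 => -(goldenRatio * widthOne θ + goldenRatio * widthFive θ)
    | .s4 => widthOne θ + goldenRatio * widthFive θ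
    | .s5 => -widthFive θ := by
  rw [Side.slope_eq, Side.normal_re, Side.normal_im, widthOne_eq, widthFive_eq]
  have hg := goldenRatio_mul_self
  have h := sin_mul_halfSide
  have h' : halfSide = 2 * sin (2 * π / 5) * (2 - goldenRatio) := rfl
  generalize sin (2 * π / 5) = x at *
  generalize goldenRatio = g at *
  rcases s with _ | _ | _ | _ | _ <;> dsimp only <;> grind

/-- The four differences are the translations `target - left` of I, II, III, IV: each crossing
shifts the offset by twice that of the normal. -/
theorem offset_normal_sub (θ : ℝ) :
    2 * offset θ (Side.normal .s3) - 2 * offset θ (Side.normal .s4) =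
      widthOne θ + goldenRatio * widthOne θ ∧
    2 * offset θ (Side.normal .s1) - 2 * offset θ (Side.normal .s4) =
      -(goldenRatio * widthFive θ) ∧
    2 * offset θ (Side.normal .s5) - 2 * offset θ (Side.normal .s2) = goldenRatio * widthOne θ ∧
    2 * offset θ (Side.normal .s3) - 2 * offset θ (Side.normal .s2) =
      -(goldenRatio * widthFive θ + widthFive θ) := by
  simp only [offset, Side.normal_re, Side.normal_im, widthOne_eq, widthFive_eq]
  have hg := goldenRatio_mul_self
  generalize sin (2 * π / 5) = x at *
  generalize goldenRatio = g at *
  refine ⟨?_, ?_, ?_, ?_⟩ <;> grind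

/-- An exit point is on the boundary, so it cannot precede the exit of the other step; and a point
of an open side determines the side. -/
theorem Step.unique {θ : ℝ} {a b c : Crossing} (hb : Step θ a b) (hc : Step θ a c)
    (hbs : b.point ∈ b.copy.openSide b.side) (hcs : c.point ∈ c.copy.openSide c.side) : b = c := by
  have key {b c : Crossing} (hcopy : c.copy = b.copy) {t u : ℝ} (ht : 0 < t) (htu : t < u)
      (hb : b.point = a.entry + t * dir θ) (hbs : b.point ∈ b.copy.openSide b.side)
      (hc : ∀ r : ℝ, 0 < r → r < u → a.entry + (r : ℂ) * dir θ ∈ c.copy.interior) : False := by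
    have h := hc t ht htu b.side
    rw [← hb, hcopy, hbs.1] at h
    exact lt_irrefl _ h
  obtain ⟨hb₁, t, ht, hbt, hbi⟩ := hb
  obtain ⟨hc₁, u, hu, hcu, hci⟩ := hc
  have hcopy : c.copy = b.copy := hc₁.trans hb₁.symm
  rcases lt_trichotomy t u with h | rfl | h
  · exact (key hcopy ht h hbt hbs hci).elim
  · have hp : b.point = c.point := hbt.trans hcu.symm
    have hs : b.side = c.side := by
      refine eq_of_mem_openSide hcs ?_
      rw [hcopy, ← hp]
      exact hbs.1
    cases b; cases c
    simp_all
  · exact (key hcopy.symm hu h hcu hcs hbi).elim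

/-- The side through which the trajectory leaves `up`. -/
def Roman.exitSide : Roman → Side
  | .I => .s4
  | .II => .s4
  | .III => .s2
  | .IV => .s2

/-- The side through which the trajectory leaves `down`. -/
def Roman.nextSide : Roman → Side
  | .I => .s3
  | .II => .s1
  | .III => .s5
  | .IV => .s3

theorem romanOfPair_eq_some {s s' : Side} {r : Roman} :
    romanOfPair s s' = some r ↔ s = r.exitSide ∧ s' = r.nextSide := by
  rcases s with _ | _ | _ | _ | _ <;> rcases s' with _ | _ | _ | _ | _ <;>
    rcases r with _ | _ | _ | _ <;> decide

/-- The coordinate on the sides 4 and 2 of `up`. -/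
def coord (θ : ℝ) (z : ℂ) : ℝ :=
  offset θ z - (offset θ (Side.normal .s4) - halfSide * Side.slope θ .s4)

section Sector

variable {θ : ℝ} (hθ : θ ∈ thirdSector)

/-- The first return map of the flow in the direction `θ`. -/
def firstReturn : IntervalExchange Roman :=
  pentagonExchange (widthOne θ) (widthFive θ) (widthOne_nonneg hθ) (widthFive_nonneg hθ)

theorem slope_pos_iff (hθ : θ ∈ thirdSector) (s : Side) :
    0 < s.slope θ ↔ s = .s4 ∨ s = .s2 := by
  have h := halfSide_mul_slope θ s
  have ha := widthOne_nonneg hθ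
  have hb := widthFive_nonneg hθ
  have hab : 0 < widthOne θ + widthFive θ := by
    refine (add_nonneg ha hb).lt_of_ne fun h => width_ne_zero hθ ⟨?_, ?_⟩ <;> linarith
  have hφ₀ := goldenRatio_pos
  have hφa := mul_nonneg hφ₀.le ha
  have hφb := mul_nonneg hφ₀.le hb
  have h₁ : widthOne θ ≤ goldenRatio * widthOne θ := le_mul_of_one_le_left ha one_lt_goldenRatio.le
  have h₂ : widthFive θ ≤ goldenRatio * widthFive θ :=
    le_mul_of_one_le_left hb one_lt_goldenRatio.le
  rw [← mul_pos_iff_of_pos_left halfSide_pos]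
  rcases s with _ | _ | _ | _ | _ <;> dsimp only at h <;> simp <;> linarith

variable {a b c : Crossing}

theorem exists_romanOfPair (hac : a.copy = .up) (ha : a.point ∈ a.copy.openSide a.side)
    (hb : b.point ∈ b.copy.openSide b.side) (hab : Step θ a b) :
    ∃ r, romanOfPair a.side b.side = some r ∧ (firstReturn hθ).Mem r (coord θ a.point) := by
  obtain ⟨hbc, has, hbs, hoff⟩ := (step_iff ha hb).1 hab
  have h₁ := abs_lt.1 (abs_offset_sub_lt ha has)
  have h₂ := abs_lt.1 (abs_offset_sub_lt hb hbs)
  have h₃ := mul_pos halfSide_pos has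
  have h₄ := mul_pos halfSide_pos hbs
  rw [hoff] at h₂
  rw [hac] at hbc h₁ h₂ h₃
  rw [hbc] at h₂ h₄
  simp only [Copy.sign, Copy.other] at h₁ h₂ h₃ h₄
  have w₁ := halfSide_mul_slope θ a.side
  have w₂ := halfSide_mul_slope θ b.side
  have w₃ := halfSide_mul_slope θ .s4
  have wa := widthOne_nonneg hθ
  have wb := widthFive_nonneg hθ
  have wφa := mul_nonneg goldenRatio_pos.le wa
  have wφb := mul_nonneg goldenRatio_pos.le wb
  obtain ⟨d₁, d₂, d₃, d₄⟩ := offset_normal_sub θ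
  generalize a.side = s at *
  generalize b.side = s' at *
  simp only [firstReturn, IntervalExchange.Mem, coord]
  -- Slopes of the wrong sign rule out most sides. Of the six pairs left, 45 and 21 fail because the
  -- projections of the two sides are disjoint.
  rcases s with _ | _ | _ | _ | _ <;> dsimp only at w₁ <;> first | (exfalso; linarith) | skip
  all_goals
    rcases s' with _ | _ | _ | _ | _ <;> dsimp only at w₂ <;> first | (exfalso; linarith) | skip
  all_goals
    refine ⟨_, rfl, ?_⟩
    simp
    constructor <;> linarith

theorem romanOfPair_of_down (hθ : θ ∈ thirdSector) (hac : a.copy = .down)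
    (ha : a.point ∈ a.copy.openSide a.side)
    (hb : b.point ∈ b.copy.openSide b.side) (hab : Step θ a b) :
    romanOfPair a.side b.side = none := by
  obtain ⟨-, has, -, -⟩ := (step_iff ha hb).1 hab
  have h := (slope_pos_iff hθ a.side).not.1 (by
    rw [hac] at has; simp only [Copy.sign] at has; linarith)
  generalize a.side = s at *
  generalize b.side = s' at *
  rcases s with _ | _ | _ | _ | _ <;> first | rfl | simp at h

theorem coord_eq_move (hac : a.copy = .up) (ha : a.point ∈ a.copy.openSide a.side)
    (hb : b.point ∈ b.copy.openSide b.side) (hc : c.point ∈ c.copy.openSide c.side)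
    (hab : Step θ a b) (hbc : Step θ b c) {r : Roman} (hr : romanOfPair a.side b.side = some r) :
    coord θ c.point = (firstReturn hθ).move r (coord θ a.point) := by
  obtain ⟨hb', -, -, h₁⟩ := (step_iff ha hb).1 hab
  obtain ⟨-, -, -, h₂⟩ := (step_iff hb hc).1 hbc
  rw [romanOfPair_eq_some] at hr
  rw [hb', hac, hr.2] at h₂
  rw [hac, hr.1] at h₁
  simp only [Copy.sign, Copy.other] at h₁ h₂
  obtain ⟨d₁, d₂, d₃, d₄⟩ := offset_normal_sub θ
  simp only [firstReturn, IntervalExchange.move, coord]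
  rcases r with _ | _ | _ | _ <;> simp only [Roman.exitSide, Roman.nextSide] at h₁ h₂ <;> simp <;>
    linarith

theorem exists_points {r : Roman} {x : ℝ} (hx : (firstReturn hθ).Mem r x) :
    ∃ z ∈ Copy.up.openSide r.exitSide, ∃ z' ∈ Copy.down.openSide r.nextSide,
      0 < r.exitSide.slope θ ∧ r.nextSide.slope θ < 0 ∧
      coord θ z = x ∧ offset θ z' = offset θ z - 2 * offset θ r.exitSide.normal ∧
      coord θ z' + 2 * offset θ r.nextSide.normal = (firstReturn hθ).move r x := by
  obtain ⟨d₁, d₂, d₃, d₄⟩ := offset_normal_sub θ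
  have w₁ := halfSide_mul_slope θ r.exitSide
  have w₂ := halfSide_mul_slope θ r.nextSide
  have w₃ := halfSide_mul_slope θ .s4
  have wa := widthOne_nonneg hθ
  have wb := widthFive_nonneg hθ
  have wφa := mul_nonneg goldenRatio_pos.le wa
  have wφb := mul_nonneg goldenRatio_pos.le wb
  have w₄ : widthOne θ ≤ goldenRatio * widthOne θ := le_mul_of_one_le_left wa one_lt_goldenRatio.le
  have w₅ : widthFive θ ≤ goldenRatio * widthFive θ :=
    le_mul_of_one_le_left wb one_lt_goldenRatio.le
  have hx₁ := hx.1
  have hx₂ := hx.2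
  -- Strictness holds even at the ends of the sector, because the interval number `r` contains `x`
  -- and so has positive length.
  have hpos : 0 < halfSide * r.exitSide.slope θ := by
    rcases r with _ | _ | _ | _ <;>
      simp [firstReturn, Roman.exitSide] at w₁ hx₁ hx₂ ⊢ <;> linarith
  have hneg : 0 < halfSide * -r.nextSide.slope θ := by
    rcases r with _ | _ | _ | _ <;>
      simp [firstReturn, Roman.nextSide] at w₂ hx₁ hx₂ ⊢ <;> linarith
  have hs := (mul_pos_iff_of_pos_left halfSide_pos).1 hpos
  have hs' := (mul_pos_iff_of_pos_left halfSide_pos).1 hneg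
  obtain ⟨z, hz, hzx⟩ := exists_mem_openSide (θ := θ) (c := .up) (s := r.exitSide)
    (x := x + (offset θ (Side.normal .s4) - halfSide * Side.slope θ .s4))
    (by simpa [Copy.sign] using hs) (by
      rw [abs_lt]
      rcases r with _ | _ | _ | _ <;>
        simp [firstReturn, Roman.exitSide, Copy.sign] at w₁ hx₁ hx₂ ⊢ <;> constructor <;> linarith)
  obtain ⟨z', hz', hzx'⟩ := exists_mem_openSide (θ := θ) (c := .down) (s := r.nextSide)
    (x := offset θ z - 2 * offset θ r.exitSide.normal)
    (by simpa [Copy.sign] using hs') (by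
      rw [abs_lt, hzx]
      rcases r with _ | _ | _ | _ <;>
        simp [firstReturn, Roman.exitSide, Roman.nextSide, Copy.sign] at w₁ w₂ hx₁ hx₂ ⊢ <;>
        constructor <;> linarith)
  refine ⟨z, hz, z', hz', hs, by linarith, by rw [coord, hzx]; ring, hzx', ?_⟩
  rw [coord, hzx', hzx]
  rcases r with _ | _ | _ | _ <;>
    simp [firstReturn, IntervalExchange.move, Roman.exitSide, Roman.nextSide] <;> linarith

end Sector

end DoublePentagon

end

/-! ### Closed trajectories as periodic orbits; lengths -/

noncomputable section

namespace DoublePentagon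

open Real

theorem Copy.other_other (c : Copy) : c.other.other = c := by cases c <;> rfl

theorem Copy.other_ne (c : Copy) : c.other ≠ c := by cases c <;> simp [Copy.other]

theorem Copy.eq_down_of_ne_up {c : Copy} (h : c ≠ .up) : c = .down := by cases c <;> simp_all

theorem count_filterMap_range {α : Type*} [DecidableEq α] (f : ℕ → Option α) (n : ℕ) (r : α) :
    ((List.range n).filterMap f).count r =
      ((Finset.range n).filter fun k => f k = some r).card := by
  induction n with
  | zero => simp
  | succ n ih =>
    rw [List.range_succ, List.filterMap_append, List.count_append, ih, Finset.range_add_one,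
      Finset.filter_insert]
    cases h : f n with
    | none => simp [h]
    | some x =>
      by_cases hx : x = r
      · subst hx; simp [h]
      · simp [h, hx]

namespace ClosedTrajectory

variable {θ : ℝ} (γ : ClosedTrajectory θ)

theorem copy_succ (k : ℕ) : (γ.crossing (k + 1)).copy = (γ.crossing k).copy.other :=
  (γ.step k).1

theorem copy_add_two (k : ℕ) : (γ.crossing (k + 2)).copy = (γ.crossing k).copy := by
  rw [γ.copy_succ, γ.copy_succ, Copy.other_other]

theorem copy_add_two_mul (k j : ℕ) : (γ.crossing (k + 2 * j)).copy = (γ.crossing k).copy := by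
  induction j with
  | zero => rfl
  | succ j ih => rw [← ih, ← γ.copy_add_two (k + 2 * j)]; rfl

theorem crossing_add_of_eq {j k : ℕ} (h : γ.crossing j = γ.crossing k) (i : ℕ) :
    γ.crossing (j + i) = γ.crossing (k + i) := by
  induction i with
  | zero => exact h
  | succ i ih =>
    have hj := γ.step (j + i)
    rw [ih] at hj
    exact hj.unique (γ.step (k + i)) (γ.mem_openSide _) (γ.mem_openSide _)

theorem crossing_injOn : Set.InjOn γ.crossing (Set.Iio γ.period) := by
  have key {j k : ℕ} (hjk : j < k) (hk : k < γ.period) : γ.crossing j ≠ γ.crossing k := fun h => by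
    have h' := γ.crossing_add_of_eq h (γ.period - k)
    rw [Nat.add_sub_cancel' hk.le] at h'
    -- An early coincidence of crossings `j` and `k` would propagate to a return to crossing 0
    -- before the prime period.
    refine γ.prime (j + (γ.period - k)) (by omega) (by omega) (h'.trans ?_)
    simpa using γ.periodic 0
  intro j hj k hk h
  rcases lt_trichotomy j k with hlt | rfl | hlt
  · exact (key hlt hk h).elim
  · rfl
  · exact (key hlt hj h.symm).elim

theorem crossing_mod (k : ℕ) : γ.crossing (k % γ.period) = γ.crossing k :=
  Function.Periodic.map_mod_nat γ.periodic k

/-- The coordinates of the crossings out of `up`. -/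
def upCoords : Finset ℝ :=
  ((Finset.range γ.period).filter fun k => (γ.crossing k).copy = .up).image
    fun k => coord θ (γ.crossing k).point

variable {γ} in
theorem mem_upCoords {x : ℝ} : x ∈ γ.upCoords ↔
    ∃ k, (γ.crossing k).copy = .up ∧ coord θ (γ.crossing k).point = x := by
  simp only [upCoords, Finset.mem_image, Finset.mem_filter, Finset.mem_range]
  constructor
  · rintro ⟨k, ⟨-, h⟩, rfl⟩
    exact ⟨k, h, rfl⟩
  · rintro ⟨k, h, rfl⟩
    refine ⟨k % γ.period, ⟨Nat.mod_lt _ γ.period_pos, ?_⟩, ?_⟩ <;> rw [γ.crossing_mod]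
    exact h

variable (hθ : θ ∈ thirdSector)

theorem exists_roman {k : ℕ} (hk : (γ.crossing k).copy = .up) :
    ∃ r, romanOfPair (γ.crossing k).side (γ.crossing (k + 1)).side = some r ∧
      (firstReturn hθ).Mem r (coord θ (γ.crossing k).point) ∧
      coord θ (γ.crossing (k + 2)).point =
        (firstReturn hθ).move r (coord θ (γ.crossing k).point) := by
  obtain ⟨r, hr, hm⟩ :=
    exists_romanOfPair hθ hk (γ.mem_openSide k) (γ.mem_openSide (k + 1)) (γ.step k)
  exact ⟨r, hr, hm, coord_eq_move hθ hk (γ.mem_openSide k) (γ.mem_openSide (k + 1))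
    (γ.mem_openSide (k + 2)) (γ.step k) (γ.step (k + 1)) hr⟩

theorem romanOfPair_eq_some_iff (k : ℕ) (r : Roman) :
    romanOfPair (γ.crossing k).side (γ.crossing (k + 1)).side = some r ↔
      (γ.crossing k).copy = .up ∧ (firstReturn hθ).Mem r (coord θ (γ.crossing k).point) := by
  by_cases hk : (γ.crossing k).copy = .up
  · obtain ⟨r', hr', hm, -⟩ := γ.exists_roman hθ hk
    rw [hr']
    constructor
    · rintro h
      obtain rfl := Option.some.inj h
      exact ⟨hk, hm⟩
    · rintro ⟨-, h⟩
      rw [hm.eq h]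
  · rw [romanOfPair_of_down hθ (Copy.eq_down_of_ne_up hk) (γ.mem_openSide k)
      (γ.mem_openSide (k + 1)) (γ.step k)]
    simp [hk]

/-- The coordinate determines the symbol, the symbol the exit side, and the offset the point on that
side. -/
theorem eq_of_coord_eq (hθ : θ ∈ thirdSector)
    {j k : ℕ} (hj : (γ.crossing j).copy = .up)
    (hk : (γ.crossing k).copy = .up) (h : coord θ (γ.crossing j).point = coord θ (γ.crossing k).point) :
    γ.crossing j = γ.crossing k := by
  obtain ⟨r, hr, hm, -⟩ := γ.exists_roman hθ hj
  obtain ⟨r', hr', hm', -⟩ := γ.exists_roman hθ hk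
  rw [h] at hm
  obtain rfl := hm.eq hm'
  have hside : (γ.crossing j).side = (γ.crossing k).side :=
    (romanOfPair_eq_some.1 hr).1.trans (romanOfPair_eq_some.1 hr').1.symm
  have hmj := γ.mem_openSide j
  have hmk := γ.mem_openSide k
  have hs := ((step_iff hmj (γ.mem_openSide (j + 1))).1 (γ.step j)).2.1
  rw [hj] at hmj hs
  rw [hk, ← hside] at hmk
  have hp := eq_of_offset_eq hmj hmk hs (sub_left_injective h)
  have hc := hj.trans hk.symm
  generalize γ.crossing j = a at *
  generalize γ.crossing k = b at *
  cases a; cases b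
  simp_all

theorem isOrbit_upCoords : (firstReturn hθ).IsOrbit γ.upCoords where
  nonempty := by
    by_cases h : (γ.crossing 0).copy = .up
    · exact ⟨_, mem_upCoords.2 ⟨0, h, rfl⟩⟩
    · refine ⟨_, mem_upCoords.2 ⟨1, ?_, rfl⟩⟩
      rw [γ.copy_succ, Copy.eq_down_of_ne_up h]
      rfl
  invariant := by
    intro x hx
    obtain ⟨k, hk, rfl⟩ := mem_upCoords.1 hx
    obtain ⟨r, -, hm, hr⟩ := γ.exists_roman hθ hk
    exact ⟨r, hm, hr ▸ mem_upCoords.2 ⟨k + 2, (γ.copy_add_two k).trans hk, rfl⟩⟩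
  minimal V hV hne hinv := by
    refine hV.antisymm fun y hy => ?_
    obtain ⟨x, hx⟩ := hne
    obtain ⟨k, hk, rfl⟩ := mem_upCoords.1 (hV hx)
    obtain ⟨l, hl, rfl⟩ := mem_upCoords.1 hy
    have hmem (j : ℕ) : coord θ (γ.crossing (k + 2 * j)).point ∈ V := by
      induction j with
      | zero => exact hx
      | succ j ih =>
        obtain ⟨r, -, hm, hr⟩ := γ.exists_roman hθ ((γ.copy_add_two_mul k j).trans hk)
        obtain ⟨r', hm', hmV⟩ := hinv _ ih
        obtain rfl := hm.eq hm'
        rwa [← hr] at hmV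
    -- Adding `k` periods brings the index `l` beyond `k`. The difference of the indices must be
    -- even, because the copies alternate and both crossings leave `up`.
    have hper : γ.crossing (l + k * γ.period) = γ.crossing l := by
      simpa using Function.Periodic.nat_mul γ.periodic k l
    have hle : k ≤ l + k * γ.period :=
      (Nat.le_mul_of_pos_right k γ.period_pos).trans (Nat.le_add_left _ _)
    obtain ⟨d, hd⟩ := Nat.exists_eq_add_of_le hle
    rw [hd] at hper
    rcases Nat.even_or_odd' d with ⟨j, rfl | rfl⟩
    · rw [← hper]
      exact hmem j
    · have := γ.copy_succ (k + 2 * j)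
      rw [add_assoc, hper, γ.copy_add_two_mul, hk, hl] at this
      exact absurd this.symm (Copy.other_ne _)

theorem visits_upCoords : (firstReturn hθ).visits γ.upCoords = γ.count := by
  funext r
  rw [count, romanWord, count_filterMap_range, IntervalExchange.visits, upCoords,
    Finset.filter_image, Finset.card_image_of_injOn, Finset.filter_filter]
  · congr 1
    exact Finset.filter_congr fun k _ => (γ.romanOfPair_eq_some_iff hθ k r).symm
  · intro j hj k hk h
    simp only [Finset.coe_filter, Finset.mem_filter, Finset.mem_range, Set.mem_ofPred_eq] at hj hk
    exact γ.crossing_injOn hj.1.1 hk.1.1 (γ.eq_of_coord_eq hθ hj.1.2 hk.1.2 h)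

theorem count_mem_visitVectors : γ.count ∈ (firstReturn hθ).visitVectors :=
  ⟨_, γ.isOrbit_upCoords hθ, γ.visits_upCoords hθ⟩

/-- A sum over the crossings of a period, in terms of the symbolic orbit. -/
theorem sum_crossing (hθ : θ ∈ thirdSector) (W : Copy → Side → ℝ) :
    ∑ k ∈ Finset.range γ.period, W (γ.crossing k).copy (γ.crossing k).side =
      ∑ r, (γ.count r : ℝ) * (W .up r.exitSide + W .down r.nextSide) := by
  set w : ℕ → ℝ := fun k => W (γ.crossing k).copy (γ.crossing k).side with hw
  -- `d` carries the weights of the crossings out of `down`. By periodicity it may be shifted by one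
  -- index, so that each joins the preceding crossing out of `up` and the two form one symbol.
  set d : ℕ → ℝ := fun k => if (γ.crossing k).copy = .up then 0 else w k with hd
  have hshift : ∑ k ∈ Finset.range γ.period, d (k + 1) = ∑ k ∈ Finset.range γ.period, d k := by
    have h := (Finset.sum_range_succ' d γ.period).symm.trans (Finset.sum_range_succ d γ.period)
    have h0 : d γ.period = d 0 := by
      have := γ.periodic 0
      rw [zero_add] at this
      simp only [hd, hw, this]
    linarith
  have hsplit : ∑ k ∈ Finset.range γ.period, w k =
      ∑ k ∈ Finset.range γ.period, ((w k - d k) + d (k + 1)) := by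
    rw [Finset.sum_add_distrib, Finset.sum_sub_distrib, hshift]
    ring
  have hterm (k : ℕ) : (w k - d k) + d (k + 1) =
      ∑ r, if romanOfPair (γ.crossing k).side (γ.crossing (k + 1)).side = some r then
        W .up r.exitSide + W .down r.nextSide else 0 := by
    by_cases hk : (γ.crossing k).copy = .up
    · obtain ⟨r, hr, -⟩ := γ.exists_roman hθ hk
      simp only [hr, Option.some.injEq, Finset.sum_ite_eq, Finset.mem_univ, if_true]
      rw [romanOfPair_eq_some] at hr
      have hk' : (γ.crossing (k + 1)).copy = .down := by rw [γ.copy_succ, hk]; rfl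
      simp [hd, hw, hk, hk', hr.1, hr.2]
    · have hk' := Copy.eq_down_of_ne_up hk
      rw [romanOfPair_of_down hθ hk' (γ.mem_openSide k) (γ.mem_openSide (k + 1)) (γ.step k)]
      have hk'' : (γ.crossing (k + 1)).copy = .up := by rw [γ.copy_succ, hk']; rfl
      simp [hd, hw, hk', hk'']
  change ∑ k ∈ Finset.range γ.period, w k = _
  rw [hsplit, Finset.sum_congr rfl fun k _ => hterm k, Finset.sum_comm]
  refine Finset.sum_congr rfl fun r _ => ?_
  rw [← Finset.sum_filter, Finset.sum_const, nsmul_eq_mul, count, romanWord,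
    count_filterMap_range]

theorem period_eq (hθ : θ ∈ thirdSector) : γ.period = 2 * ∑ r, γ.count r := by
  have h := γ.sum_crossing hθ fun _ _ => 1
  rw [← Finset.sum_mul] at h
  simp only [Finset.sum_const, Finset.card_range, nsmul_eq_mul, mul_one] at h
  have h' : (γ.period : ℝ) = ((2 * ∑ r, γ.count r : ℕ) : ℝ) := by
    push_cast
    linarith
  exact_mod_cast h'

theorem norm_sub_entry (k : ℕ) :
    ‖(γ.crossing (k + 1)).point - (γ.crossing k).entry‖ =
      inner ℝ (dir θ) (γ.crossing (k + 1)).point - inner ℝ (dir θ) (γ.crossing k).point +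
        2 * ((γ.crossing k).copy.sign * (γ.crossing k).side.slope θ) := by
  obtain ⟨-, t, ht, hp, -⟩ := γ.step k
  have hd : ‖dir θ‖ = 1 := Complex.norm_exp_ofReal_mul_I θ
  rw [hp, add_sub_cancel_left, norm_mul, hd, mul_one, Complex.norm_real, norm_of_nonneg ht.le]
  simp only [Crossing.entry, Side.slope_eq, inner_eq, dir_re, dir_im]
  simp [dir_re, dir_im]
  linear_combination (-t) * sin_sq_add_cos_sq θ

/-- The components of the positions along `dir θ` telescope to zero over a period; only the jumps of
the gluings remain. -/
theorem length_eq_sum : γ.length =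
    ∑ k ∈ Finset.range γ.period, 2 * ((γ.crossing k).copy.sign * (γ.crossing k).side.slope θ) := by
  have h := γ.periodic 0
  rw [zero_add] at h
  rw [length, Finset.sum_congr rfl fun k _ => γ.norm_sub_entry k, Finset.sum_add_distrib,
    Finset.sum_range_sub (fun k => (inner ℝ (dir θ) (γ.crossing k).point : ℝ)), h, sub_self, zero_add]

theorem length_pos : 0 < γ.length := by
  rw [length_eq_sum]
  refine Finset.sum_pos (fun k _ => mul_pos two_pos ?_)
    (Finset.nonempty_range_iff.2 γ.period_pos.ne')
  exact ((step_iff (γ.mem_openSide k) (γ.mem_openSide (k + 1))).1 (γ.step k)).2.1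

theorem length_eq (hθ : θ ∈ thirdSector) : γ.length =
    2 * ∑ r, (γ.count r : ℝ) * (r.exitSide.slope θ - r.nextSide.slope θ) := by
  rw [length_eq_sum, γ.sum_crossing hθ fun c s => 2 * (c.sign * s.slope θ), Finset.mul_sum]
  refine Finset.sum_congr rfl fun r _ => ?_
  simp only [Copy.sign]
  ring

end ClosedTrajectory

theorem exists_closedTrajectory {θ : ℝ} (hθ : θ ∈ thirdSector) {n : Roman → ℕ}
    (hn : n ∈ (firstReturn hθ).visitVectors) : ∃ γ : ClosedTrajectory θ, γ.count = n := by
  obtain ⟨O, hO, rfl⟩ := hn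
  -- By minimality of `O`, a trajectory whose coordinates lie in `O` fills it.
  suffices h : ∃ γ : ClosedTrajectory θ, γ.upCoords ⊆ O by
    obtain ⟨γ, hγ⟩ := h
    refine ⟨γ, ?_⟩
    have horb := γ.isOrbit_upCoords hθ
    rw [← hO.minimal _ hγ horb.nonempty horb.invariant, γ.visits_upCoords hθ]
  obtain ⟨x₀, hx₀⟩ := hO.nonempty
  have : Nonempty Roman := ⟨.I⟩
  choose! rom hmem hmove using hO.invariant
  choose! Z hZ Z' hZ' hs hs' hZx hZZ' hZ'' using fun x hx => exists_points hθ (hmem x hx)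
  set F : ℝ → ℝ := fun x => (firstReturn hθ).move (rom x) x with hF
  have hFO (k : ℕ) {x : ℝ} (hx : x ∈ O) : F^[k] x ∈ O :=
    Set.MapsTo.iterate (s := (O : Set ℝ)) (fun y hy => hmove y hy) k hx
  -- By the pigeonhole principle, some iterate in the finite set `O` is periodic.
  obtain ⟨y, hy, hper⟩ : ∃ y ∈ O, y ∈ Function.periodicPts F := by
    obtain ⟨i, j, hij, h⟩ := Finite.exists_ne_map_eq_of_infinite
      (fun k : ℕ => (⟨F^[k] x₀, hFO k hx₀⟩ : O))
    have h : F^[i] x₀ = F^[j] x₀ := congrArg Subtype.val h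
    rcases hij.lt_or_gt with hlt | hlt
    · refine ⟨_, hFO i hx₀, Function.mk_mem_periodicPts (Nat.sub_pos_of_lt hlt) ?_⟩
      rw [Function.IsPeriodicPt, Function.IsFixedPt, ← Function.iterate_add_apply,
        Nat.sub_add_cancel hlt.le, h]
    · refine ⟨_, hFO j hx₀, Function.mk_mem_periodicPts (Nat.sub_pos_of_lt hlt) ?_⟩
      rw [Function.IsPeriodicPt, Function.IsFixedPt, ← Function.iterate_add_apply,
        Nat.sub_add_cancel hlt.le, h]
  set p := Function.minimalPeriod F y with hp
  have hp₀ : 0 < p := Function.minimalPeriod_pos_of_mem_periodicPts hper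
  let up (x : ℝ) : Crossing := ⟨.up, (rom x).exitSide, Z x⟩
  let down (x : ℝ) : Crossing := ⟨.down, (rom x).nextSide, Z' x⟩
  let cr (k : ℕ) : Crossing := if k % 2 = 0 then up (F^[k / 2] y) else down (F^[k / 2] y)
  have cr_even (j : ℕ) : cr (2 * j) = up (F^[j] y) := by simp [cr]
  have cr_odd (j : ℕ) : cr (2 * j + 1) = down (F^[j] y) := by
    have : (2 * j + 1) / 2 = j := by omega
    simp [cr, Nat.add_mod, this]
  have hcr (k : ℕ) : (cr k).point ∈ (cr k).copy.openSide (cr k).side := by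
    rcases Nat.even_or_odd' k with ⟨j, rfl | rfl⟩
    · rw [cr_even]; exact hZ _ (hFO j hy)
    · rw [cr_odd]; exact hZ' _ (hFO j hy)
  -- Each return consists of a crossing out of `up` and one out of `down`, so the period is `2 * p`.
  -- It is prime: odd returns end in the wrong copy, shorter even ones contradict the minimality of
  -- `p`.
  refine ⟨⟨cr, 2 * p, by omega, hcr, fun k => ?_, fun k => ?_, fun m hm hmp h => ?_⟩, ?_⟩
  · rw [step_iff (hcr k) (hcr (k + 1))]
    rcases Nat.even_or_odd' k with ⟨j, rfl | rfl⟩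
    · have hj := hFO j hy
      rw [cr_even, cr_odd]
      refine ⟨rfl, ?_, ?_, ?_⟩ <;> simp only [up, down, Copy.sign]
      · linarith [hs _ hj]
      · linarith [hs' _ hj]
      · rw [hZZ' _ hj]; ring
    · have hj := hFO j hy
      have hj' := hFO (j + 1) hy
      rw [cr_odd, show 2 * j + 1 + 1 = 2 * (j + 1) by ring, cr_even]
      refine ⟨rfl, ?_, ?_, ?_⟩ <;> simp only [up, down, Copy.sign]
      · linarith [hs' _ hj]
      · linarith [hs _ hj']
      · have h₁ := hZ'' _ hj
        have h₂ := hZx _ hj'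
        rw [Function.iterate_succ_apply'] at h₂ ⊢
        have h₃ := h₂.trans h₁.symm
        simp only [coord] at h₃
        linarith
  · rcases Nat.even_or_odd' k with ⟨j, rfl | rfl⟩
    · rw [← mul_add, cr_even, cr_even, Function.iterate_add_minimalPeriod_eq]
    · rw [add_right_comm, ← mul_add, cr_odd, cr_odd, Function.iterate_add_minimalPeriod_eq]
  · rcases Nat.even_or_odd' m with ⟨j, rfl | rfl⟩
    · rw [cr_even, ← mul_zero 2, cr_even] at h
      have h' : Z (F^[j] y) = Z y := congrArg Crossing.point h
      have h'' : F^[j] y = y := by rw [← hZx _ (hFO j hy), h', hZx _ hy]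
      exact Function.not_isPeriodicPt_of_pos_of_lt_minimalPeriod (by omega : j ≠ 0) (by omega) h''
    · rw [cr_odd, ← mul_zero 2, cr_even] at h
      exact Copy.noConfusion (congrArg Crossing.copy h)
  · intro x hx
    obtain ⟨k, hk, rfl⟩ := ClosedTrajectory.mem_upCoords.1 hx
    change (cr k).copy = .up at hk
    change coord θ (cr k).point ∈ O
    rcases Nat.even_or_odd' k with ⟨j, rfl | rfl⟩
    · rw [cr_even]
      change coord θ (Z (F^[j] y)) ∈ O
      rw [hZx _ (hFO j hy)]
      exact hFO j hy
    · rw [cr_odd] at hk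
      exact Copy.noConfusion hk

/-- The differences are half the lengths contributed by the symbols: I weighs φ times III, and IV
weighs φ times II. So the weights form an eigenvector of the transpose of M. -/
theorem slope_relations (θ : ℝ) :
    Side.slope θ .s4 - Side.slope θ .s3 =
      goldenRatio * (Side.slope θ .s2 - Side.slope θ .s5) ∧
    Side.slope θ .s2 - Side.slope θ .s3 =
      goldenRatio * (Side.slope θ .s4 - Side.slope θ .s1) := by
  have hg := goldenRatio_mul_self
  constructor <;> refine mul_left_cancel₀ (mul_pos two_pos halfSide_pos).ne' ?_ <;>
    simp only [mul_sub, mul_left_comm _ goldenRatio, mul_assoc, halfSide_mul_slope]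
  · linear_combination (-widthOne θ) * hg
  · linear_combination (-widthFive θ) * hg

theorem ClosedTrajectory.length_of_relate {θ : ℝ} (hθ : θ ∈ thirdSector)
    {γ Γ : ClosedTrajectory θ} (h : Γ.count = relate γ.count) :
    Γ.length = goldenRatio * γ.length := by
  obtain ⟨h₁, h₂⟩ := slope_relations θ
  have hg := goldenRatio_mul_self
  rw [Γ.length_eq hθ, γ.length_eq hθ, h]
  simp only [sum_roman, relate, Roman.exitSide, Roman.nextSide, h₁, h₂]
  push_cast
  linear_combination (-2 * γ.count .I * (Side.slope θ .s2 - Side.slope θ .s5) -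
    2 * γ.count .IV * (Side.slope θ .s4 - Side.slope θ .s1)) * hg

end DoublePentagon

end

/-! ### The theorem -/

theorem theorem7 (θ : ℝ) (hθ : θ ∈ DoublePentagon.thirdSector)
    (hper : DoublePentagon.IsPeriodicDirection θ) :
    (∃ γ : DoublePentagon.ClosedTrajectory θ, γ.IsShort) ∧
    (∃ Γ : DoublePentagon.ClosedTrajectory θ, Γ.IsLong) ∧
    (∀ δ : DoublePentagon.ClosedTrajectory θ, δ.IsShort ∨ δ.IsLong) ∧
    (∀ γ Γ : DoublePentagon.ClosedTrajectory θ, γ.IsShort → Γ.IsLong →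
      γ.period ≤ Γ.period ∧
      (Γ.count .I = γ.count .I + γ.count .III ∧
        Γ.count .II = γ.count .IV ∧
        Γ.count .III = γ.count .I ∧
        Γ.count .IV = γ.count .II + γ.count .IV) ∧
      Γ.countVec = DoublePentagon.relMatrix.mulVec γ.countVec) ∧
    DoublePentagon.relMatrix ^ 2 = DoublePentagon.relMatrix + 1 := by
  open DoublePentagon in
  obtain ⟨γ₁⟩ := hper
  obtain ⟨v, hv⟩ := exists_visitVectors_eq (widthOne_nonneg hθ) (widthFive_nonneg hθ)
    (width_ne_zero hθ) ⟨_, γ₁.count_mem_visitVectors hθ⟩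
  have hv : (firstReturn hθ).visitVectors = {v, relate v} := hv
  obtain ⟨γ₀, h₀⟩ := exists_closedTrajectory hθ (n := v) (by simp [hv])
  obtain ⟨Γ₀, H₀⟩ := exists_closedTrajectory hθ (n := relate v) (by simp [hv])
  have hlen {γ Γ : ClosedTrajectory θ} (h : γ.count = v) (H : Γ.count = relate v) :
      γ.length < Γ.length := by
    rw [ClosedTrajectory.length_of_relate hθ (γ := γ) (Γ := Γ) (by rw [h, H])]
    exact lt_mul_of_one_lt_left γ.length_pos Real.one_lt_goldenRatio
  have hsame {γ δ : ClosedTrajectory θ} (h : γ.count = δ.count) : γ.length = δ.length := by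
    rw [γ.length_eq hθ, δ.length_eq hθ, h]
  have hcases (δ : ClosedTrajectory θ) : δ.count = v ∨ δ.count = relate v := by
    have := δ.count_mem_visitVectors hθ
    rwa [hv] at this
  -- Both count vectors are realized, by `γ₀` and `Γ₀`, so the extremal lengths are those of `v` and
  -- `relate v`.
  have hshort (γ : ClosedTrajectory θ) : γ.IsShort ↔ γ.count = v := by
    refine ⟨fun h => (hcases γ).resolve_right fun H => (hlen h₀ H).not_ge (h γ₀), fun h δ => ?_⟩
    rcases hcases δ with hδ | hδ
    · exact (hsame (h.trans hδ.symm)).le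
    · exact (hlen h hδ).le
  have hlong (Γ : ClosedTrajectory θ) : Γ.IsLong ↔ Γ.count = relate v := by
    refine ⟨fun h => (hcases Γ).resolve_left fun H => (hlen H H₀).not_ge (h Γ₀), fun h δ => ?_⟩
    rcases hcases δ with hδ | hδ
    · exact (hlen hδ h).le
    · exact (hsame (hδ.trans h.symm)).le
  refine ⟨⟨γ₀, (hshort _).2 h₀⟩, ⟨Γ₀, (hlong _).2 H₀⟩,
    fun δ => (hcases δ).imp (hshort δ).2 (hlong δ).2, fun γ Γ hγ hΓ => ?_, by decide⟩
  have hrel : Γ.count = relate γ.count := by rw [(hlong Γ).1 hΓ, (hshort γ).1 hγ]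
  refine ⟨?_, ?_, ?_⟩
  -- `relate` increases the total by the numbers of I and IV.
  · rw [γ.period_eq hθ, Γ.period_eq hθ, hrel]
    simp only [sum_roman, relate]
    omega
  · rw [hrel]
    exact ⟨rfl, rfl, rfl, rfl⟩
  · funext i
    fin_cases i <;>
      simp [ClosedTrajectory.countVec, hrel, relate, relMatrix, Matrix.mulVec, dotProduct,
        Fin.sum_univ_four]
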